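/- For a finite multiset $Y$ of $n$ points of $\mathbb{R}^d$ (counted with multiplicity), a nonempty finite set $C\subset\mathbb{R}^d$ and weights $v=(v_1,\dots,v_n)$, let $$\mathrm{cost}_v(Y,C)=\sum_{i=1}^n v_i\, d(y_i,C),\qquad d(y,C)=\min_{c\in C}\|y-c\|_2,$$ where the points of $Y$ are numbered so that $d(y_1,C)\ge\dots\ge d(y_n,C)$. Let $X\subset\mathbb{R}^d$ be a set of $n$ points. A simultaneous $\varepsilon$-coreset of $X$ for Ordered $k$-Median is a multiset $D$ of $n$ points of $\mathbb{R}^d$ (counted with multiplicity) such that $$(1-\varepsilon)\,\mathrm{cost}_v(X,C)\le \mathrm{cost}_v(D,C)\le(1+\varepsilon)\,\mathrm{cost}_v(X,C)$$ for all $C\subset\mathbb{R}^d$ with $|C|=k$ and all $v_1\ge\dots\ge v_n\ge 0$ at once; its size is the number of distinct points in $D$. Theorem. There is an absolute constant $A$ such that for every $k\ge 1$, $\varepsilon\in(0,1)$ and every set $X\subset\mathbb{R}^d$ of $n\ge 2$ points there is a simultaneous $\varepsilon$-coreset of $X$ for Ordered $k$-Median of size at most $$A^d\cdot\frac{k^2\log^2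 n}{\varepsilon^d}.$$ Moreover, such a coreset can be computed in polynomial time: a single real-RAM program (exact unit-cost $+,-,\times,/$ and comparison on real numbers; unit-cost addition, truncated subtraction and comparison on natural numbers, which serve as addresses), given $n$, $d$, $k$, $\varepsilon$ and the points of $X$ in any order, outputs the distinct points of such a coreset with their multiplicities after a number of steps that is bounded by a fixed polynomial in $nd$. -/

import Mathlib

noncomputable section

/-! ### The Ordered k-Median objective and simultaneous coresets -/

namespace OrderedMedian

/-- The distances `d(x, C)` of the points of the multiset `X` to the center set `C`,
listed in non-increasing order. -/
def sortedDist {d : ℕ} (X : Multiset (EuclideanSpace ℝ (Fin d)))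
    (C : Finset (EuclideanSpace ℝ (Fin d))) : List ℝ :=
  (X.map fun x => Metric.infDist x (C : Set (EuclideanSpace ℝ (Fin d)))).sort (· ≥ ·)

/-- `cost_v(X, C) = ∑ v_i d(x_i, C)` where `d(x_1, C) ≥ d(x_2, C) ≥ ⋯`. It is only used for
multisets `X` with exactly `n` points (counted with multiplicity). -/
def cost {d n : ℕ} (v : Fin n → ℝ) (X : Multiset (EuclideanSpace ℝ (Fin d)))
    (C : Finset (EuclideanSpace ℝ (Fin d))) : ℝ :=
  ∑ i : Fin n, v i * (sortedDist X C).getD i 0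

/-- `D` is a simultaneous `ε`-coreset of `X` for Ordered `k`-Median: `D` is a multiset with the
same total multiplicity as `X`, and the cost is preserved up to a factor `1 ± ε` for every set of
`k` centers and every non-increasing vector of non-negative weights. -/
def IsSimultaneousCoreset {d : ℕ} (k : ℕ) (ε : ℝ)
    (X D : Multiset (EuclideanSpace ℝ (Fin d))) : Prop :=
  D.card = X.card ∧
    ∀ C : Finset (EuclideanSpace ℝ (Fin d)), C.card = k →
      ∀ v : Fin X.card → ℝ, Antitone v → (∀ i, 0 ≤ v i) →
        (1 - ε) * cost v X C ≤ cost v D C ∧ cost v D C ≤ (1 + ε) * cost v X C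

open Classical in
/-- The size of a coreset: the number of distinct points in it. -/
def size {d : ℕ} (D : Multiset (EuclideanSpace ℝ (Fin d))) : ℕ := D.toFinset.card

end OrderedMedian

/-! ### A real RAM with step count

Real numbers are handled by `+, -, *, /` and comparison only (no rounding, no roots); natural
numbers, which also serve as addresses, by addition, truncated subtraction and comparison only. -/

namespace RealRAM

/-- Registers and memory cells, for natural numbers and for real numbers. -/
structure State where
  natReg : ℕ → ℕ
  natMem : ℕ → ℕ
  realReg : ℕ → ℝ
  realMem : ℕ → ℝ

/-- Elementary instructions; all parameters except constants are numbers of registers.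
The first parameter is the target (for the `store` instructions: the register with the address). -/
inductive Instr where
  | skip
  | natConst (a c : ℕ)
  | natAdd (a b c : ℕ)
  | natSub (a b c : ℕ)
  | natLoad (a b : ℕ)
  | natStore (a b : ℕ)
  | realConst (a : ℕ) (z : ℤ)
  | realAdd (a b c : ℕ)
  | realSub (a b c : ℕ)
  | realMul (a b c : ℕ)
  | realDiv (a b c : ℕ)
  | realLoad (a b : ℕ)
  | realStore (a b : ℕ)

/-- The effect of an elementary instruction. -/
def Instr.run : Instr → State → State
  | .skip, s => s
  | .natConst a c, s => { s with natReg := Function.update s.natReg a c }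
  | .natAdd a b c, s =>
      { s with natReg := Function.update s.natReg a (s.natReg b + s.natReg c) }
  | .natSub a b c, s =>
      { s with natReg := Function.update s.natReg a (s.natReg b - s.natReg c) }
  | .natLoad a b, s =>
      { s with natReg := Function.update s.natReg a (s.natMem (s.natReg b)) }
  | .natStore a b, s =>
      { s with natMem := Function.update s.natMem (s.natReg a) (s.natReg b) }
  | .realConst a z, s => { s with realReg := Function.update s.realReg a (z : ℝ) }
  | .realAdd a b c, s =>
      { s with realReg := Function.update s.realReg a (s.realReg b + s.realReg c) }
  | .realSub a b c, s =>
      { s with realReg := Function.update s.realReg a (s.realReg b - s.realReg c) }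
  | .realMul a b c, s =>
      { s with realReg := Function.update s.realReg a (s.realReg b * s.realReg c) }
  | .realDiv a b c, s =>
      { s with realReg := Function.update s.realReg a (s.realReg b / s.realReg c) }
  | .realLoad a b, s =>
      { s with realReg := Function.update s.realReg a (s.realMem (s.natReg b)) }
  | .realStore a b, s =>
      { s with realMem := Function.update s.realMem (s.natReg a) (s.realReg b) }

/-- Tests: comparison of two registers. -/
inductive Test where
  | natLe (a b : ℕ)
  | realLe (a b : ℕ)

def Test.Holds : Test → State → Prop
  | .natLe a b, s => s.natReg a ≤ s.natReg b
  | .realLe a b, s => s.realReg a ≤ s.realReg b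

/-- Programs: finite structured programs. -/
inductive Prog where
  | instr (i : Instr)
  | seq (p q : Prog)
  | ite (c : Test) (p q : Prog)
  | while (c : Test) (p : Prog)

/-- `Exec p s t s'`: started in state `s`, the program `p` halts in state `s'` after exactly `t`
steps, where every elementary instruction and every evaluation of a test is one step. -/
inductive Exec : Prog → State → ℕ → State → Prop where
  | instr (i : Instr) (s : State) : Exec (.instr i) s 1 (i.run s)
  | seq {p q : Prog} {s s' s'' : State} {t t' : ℕ} :
      Exec p s t s' → Exec q s' t' s'' → Exec (.seq p q) s (t + t') s''
  | iteTrue {c : Test} {p q : Prog} {s s' : State} {t : ℕ} :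
      c.Holds s → Exec p s t s' → Exec (.ite c p q) s (t + 1) s'
  | iteFalse {c : Test} {p q : Prog} {s s' : State} {t : ℕ} :
      ¬ c.Holds s → Exec q s t s' → Exec (.ite c p q) s (t + 1) s'
  | whileTrue {c : Test} {p : Prog} {s s' s'' : State} {t t' : ℕ} :
      c.Holds s → Exec p s t s' → Exec (.while c p) s' t' s'' →
        Exec (.while c p) s (t + t' + 1) s''
  | whileFalse {c : Test} {p : Prog} {s : State} :
      ¬ c.Holds s → Exec (.while c p) s 1 s

/-- The initial state for the instance `(n, d, k, ε, x_0, …, x_{n-1})`: the first three natural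
registers hold `n, d, k`, the first real register holds `ε`, and the `j`-th coordinate of `x_i` is
in real memory cell `i * d + j`; everything else is `0`. -/
def inputState {n d : ℕ} (k : ℕ) (ε : ℝ) (x : Fin n → EuclideanSpace ℝ (Fin d)) : State where
  natReg a := if a = 0 then n else if a = 1 then d else if a = 2 then k else 0
  natMem _ := 0
  realReg a := if a = 0 then ε else 0
  realMem a :=
    if h : a < n * d then
      x (finProdFinEquiv.symm ⟨a, h⟩).1 (finProdFinEquiv.symm ⟨a, h⟩).2
    else 0

open Classical in
/-- The state `s` represents the multiset `D`: for some enumeration `y_0, …, y_{m-1}` of its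
distinct points, `m` is in natural register `0`, the multiplicity of `y_i` is in natural memory
cell `i`, and the `j`-th coordinate of `y_i` is in real memory cell `i * d + j`. -/
def Represents {d : ℕ} (s : State) (D : Multiset (EuclideanSpace ℝ (Fin d))) : Prop :=
  s.natReg 0 = OrderedMedian.size D ∧
    ∃ y : Fin (OrderedMedian.size D) → EuclideanSpace ℝ (Fin d),
      Function.Injective y ∧ ∀ i, y i ∈ D ∧ s.natMem i = D.count (y i) ∧
        ∀ j : Fin d, s.realMem (i * d + j) = y i j

end RealRAM

end

/-! The coreset moves every point of `x` to a nearby representative. The scale of the move is found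
by a peeling that depends on neither the centers nor the weights. While a set `U` of points is left,
take the smallest ball that is centered at a point of `U`, passes through a point of `U` and
contains at least `|U| / (2k)` points of `U`, and remove its points. A removed point `i` remembers
the squared radius `m i` and the number `u i` of points present before its round.

Error. Let `s w` be the entry at position `w` of the sorted distances to some `k` centers. At most
`u i / 2` points are farther than `s (u i / 2)` from the centers, so at least half of the points
present are within that distance. By pigeonhole one center serves a `1 / (2k)` fraction of them, and
these lie in a ball of radius `2 * s (u i / 2)` around any one of them (`exists_heavy_le`).
Minimality of the ball gives `√(m i) ≤ 2 * s (u i / 2)`. Moving `i` by at most `ε / 4 * √(m i)` thus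
costs at most `ε / 2 * s (u i / 2)`. At most `w` points have `u i ≤ w`, so by rearrangement the
weighted total is at most `ε / 2 * ∑ v i * s (i / 2)` (`sum_mul_comp_le_of_card_le`), and halving
the index costs only a factor `2` (`sum_mul_half_le`). This yields `Peeled.isSimultaneousCoreset`.

Size. Each round shrinks `U` by the factor `1 - 1 / (2k)`, so there are at most `2k log n + 1`
rounds. Representatives from one round lie in one ball of radius `g` and have mutual distance at
least `ε / 4 * g`, so a volume argument allows at most `(9 / ε) ^ d` of them (`Peeled.card_le`).

Algorithm. Comparing radii and distances only needs squared distances, so no roots are taken. An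
exhaustive search over pairs finds each ball, and a greedy net (`Net`) chooses the representatives.
Programs are verified with step-counting rules for `HaltsIn` and the frame condition `EqBelow`. -/

noncomputable section

namespace OrderedMedian

/-! ### Packing, sorted distances and rearrangement. -/

open MeasureTheory Metric Module in
/-- Volume bound for packings: an `s`-separated set in a ball of radius `g` has at most
`(1 + 2 g / s) ^ dim` points. -/
theorem card_le_of_pairwise_le_dist {E : Type*} [NormedAddCommGroup E] [NormedSpace ℝ E]
    [FiniteDimensional ℝ E] (S : Finset E) (c : E) {g s : ℝ} (hg : 0 ≤ g) (hs : 0 < s)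
    (hball : ∀ p ∈ S, dist p c ≤ g)
    (hsep : (S : Set E).Pairwise fun p q => s ≤ dist p q) :
    (S.card : ℝ) ≤ (1 + 2 * g / s) ^ finrank ℝ E := by
  borelize E
  let μ : Measure E := Measure.addHaar
  have hδ : 0 < s / 2 := by positivity
  have hρ : 0 < g + s / 2 := by positivity
  -- Disjoint balls of radius `s / 2` fit into one ball of radius `g + s / 2`; comparing Haar
  -- measures leaves the ratio of the radii to the power of the dimension.
  have hdisj : Set.Pairwise (S : Set E) (Function.onFun Disjoint fun p => ball p (s / 2)) := by
    intro p hp q hq hpq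
    apply ball_disjoint_ball
    linarith [hsep hp hq hpq]
  have hsub : (⋃ p ∈ S, ball p (s / 2)) ⊆ ball c (g + s / 2) := by
    refine Set.iUnion₂_subset fun p hp => ball_subset_ball' ?_
    linarith [hball p hp]
  have hle : (S.card : ENNReal) * ENNReal.ofReal ((s / 2) ^ finrank ℝ E) * μ (ball 0 1) ≤
      ENNReal.ofReal ((g + s / 2) ^ finrank ℝ E) * μ (ball 0 1) :=
    calc
      _ = μ (⋃ p ∈ S, ball p (s / 2)) := by
        rw [measure_biUnion_finset hdisj fun c _ => measurableSet_ball]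
        simp only [μ.addHaar_ball_of_pos _ hδ, Finset.sum_const, nsmul_eq_mul, mul_assoc]
      _ ≤ μ (ball c (g + s / 2)) := measure_mono hsub
      _ = _ := by simp only [μ.addHaar_ball_of_pos _ hρ]
  have hle' : (S.card : ENNReal) * ENNReal.ofReal ((s / 2) ^ finrank ℝ E) ≤
      ENNReal.ofReal ((g + s / 2) ^ finrank ℝ E) :=
    (ENNReal.mul_le_mul_iff_left (measure_ball_pos _ _ zero_lt_one).ne' measure_ball_lt_top.ne).1
      hle
  have hreal := ENNReal.toReal_le_of_le_ofReal (pow_nonneg hρ.le _) hle'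
  rw [ENNReal.toReal_mul, ENNReal.toReal_natCast, ENNReal.toReal_ofReal (by positivity)] at hreal
  have heq : 1 + 2 * g / s = (g + s / 2) / (s / 2) := by field_simp; ring
  rw [heq, div_pow, le_div_iff₀ (by positivity)]
  exact hreal

/-- The sorted list of distances of an indexed family is a reordering of the distances. -/
theorem exists_perm_sortedDist {d n : ℕ} (y : Fin n → EuclideanSpace ℝ (Fin d))
    (C : Finset (EuclideanSpace ℝ (Fin d))) :
    ∃ σ : Equiv.Perm (Fin n),
      Antitone (fun i => Metric.infDist (y (σ i)) (C : Set (EuclideanSpace ℝ (Fin d)))) ∧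
      sortedDist (Finset.univ.val.map y) C =
        List.ofFn fun i => Metric.infDist (y (σ i)) (C : Set (EuclideanSpace ℝ (Fin d))) := by
  set b : Fin n → ℝ := fun i => Metric.infDist (y i) (C : Set (EuclideanSpace ℝ (Fin d))) with hb
  let σ := Tuple.sort fun i => OrderDual.toDual (b i)
  have hσ : Antitone (fun i => b (σ i)) :=
    fun i j hij => Tuple.monotone_sort (fun i => OrderDual.toDual (b i)) hij
  refine ⟨σ, hσ, ?_⟩
  unfold sortedDist
  refine List.Perm.eq_of_pairwise (le := (· ≥ ·)) ?_ (Multiset.pairwise_sort _ _) ?_ ?_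
  · intro a b _ _ h1 h2
    exact le_antisymm h2 h1
  · rw [List.pairwise_ofFn]
    intro i j hij
    exact hσ hij.le
  · rw [← Multiset.coe_eq_coe, Multiset.sort_eq, Multiset.map_map]
    have h1 : (List.ofFn fun i => b (σ i) : List ℝ) = (List.finRange n).map fun i => b (σ i) := by
      rw [List.ofFn_eq_map]
    have h2 : ((List.ofFn fun i => b (σ i) : List ℝ) : Multiset ℝ) =
        (Finset.univ : Finset (Fin n)).val.map (b ∘ σ) := by
      rw [h1]; rfl
    rw [h2, ← Multiset.map_map (g := b) (f := σ), Multiset.map_univ_val_equiv]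
    rfl

/-- The cost is the largest value of `∑ v_i d(y_{σ i}, C)` over all reorderings `σ`. -/
theorem exists_perm_cost {d n : ℕ} (y : Fin n → EuclideanSpace ℝ (Fin d))
    (C : Finset (EuclideanSpace ℝ (Fin d))) (v : Fin n → ℝ) :
    (∃ σ : Equiv.Perm (Fin n), cost v (Finset.univ.val.map y) C =
      ∑ i, v i * Metric.infDist (y (σ i)) (C : Set (EuclideanSpace ℝ (Fin d)))) ∧
    (Antitone v → ∀ τ : Equiv.Perm (Fin n),
      ∑ i, v i * Metric.infDist (y (τ i)) (C : Set (EuclideanSpace ℝ (Fin d))) ≤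
        cost v (Finset.univ.val.map y) C) := by
  obtain ⟨σ, hσ, hs⟩ := exists_perm_sortedDist y C
  have hc : cost v (Finset.univ.val.map y) C =
      ∑ i, v i * Metric.infDist (y (σ i)) (C : Set (EuclideanSpace ℝ (Fin d))) := by
    unfold cost
    rw [hs]
    refine Finset.sum_congr rfl fun i _ => ?_
    rw [List.getD_eq_getElem _ _ (by simp)]
    simp
  refine ⟨⟨σ, hc⟩, fun hv τ => ?_⟩
  -- Rearrangement inequality: weights and distances listed by `σ` are both non-increasing, and `τ`
  -- is expressed relative to `σ`.
  have := (Monovary.sum_mul_comp_perm_le_sum_mul (σ := τ.trans σ.symm) (hv.monovary hσ))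
  rw [hc]
  simpa using this

/-- The entry of the sorted list at position `w` bounds all distances except at most `w`. -/
theorem card_lt_infDist_le {d n : ℕ} (y : Fin n → EuclideanSpace ℝ (Fin d))
    (C : Finset (EuclideanSpace ℝ (Fin d))) (w : ℕ) :
    (Finset.univ.filter fun l => (sortedDist (Finset.univ.val.map y) C).getD w 0 <
      Metric.infDist (y l) (C : Set (EuclideanSpace ℝ (Fin d)))).card ≤ w := by
  obtain ⟨σ, hσ, hs⟩ := exists_perm_sortedDist y C
  by_cases hw : w < n
  · have hget : (sortedDist (Finset.univ.val.map y) C).getD w 0 =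
        Metric.infDist (y (σ ⟨w, hw⟩)) (C : Set (EuclideanSpace ℝ (Fin d))) := by
      rw [hs, List.getD_eq_getElem _ _ (by simpa using hw)]
      simp
    rw [hget]
    calc _ ≤ ((Finset.univ.filter fun i : Fin n => (i : ℕ) < w).map σ.toEmbedding).card := by
          refine Finset.card_le_card fun l hl => ?_
          simp only [Finset.mem_filter, Finset.mem_univ, true_and] at hl
          simp only [Finset.mem_map, Finset.mem_filter, Finset.mem_univ, true_and]
          refine ⟨σ.symm l, ?_, by simp⟩
          by_contra hcon
          have := hσ (show (⟨w, hw⟩ : Fin n) ≤ σ.symm l from not_lt.1 hcon)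
          simp only [Equiv.apply_symm_apply] at this
          linarith
      _ ≤ w := by
          rw [Finset.card_map]
          calc _ ≤ ((Finset.univ.filter fun i : Fin n => (i : ℕ) < w).map
                Fin.valEmbedding).card := by rw [Finset.card_map]
            _ ≤ (Finset.range w).card := by
                refine Finset.card_le_card fun i hi => ?_
                simp only [Finset.mem_map, Finset.mem_filter] at hi
                obtain ⟨a, ha, rfl⟩ := hi
                simpa using ha.2
            _ = w := by simp
  · exact (Finset.card_le_univ _).trans (by simpa using not_lt.1 hw)

theorem sortedDist_getD_nonneg {d n : ℕ} (y : Fin n → EuclideanSpace ℝ (Fin d))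
    (C : Finset (EuclideanSpace ℝ (Fin d))) (w : ℕ) :
    0 ≤ (sortedDist (Finset.univ.val.map y) C).getD w 0 := by
  obtain ⟨σ, -, hs⟩ := exists_perm_sortedDist y C
  rw [hs]
  by_cases hw : w < n
  · rw [List.getD_eq_getElem _ _ (by simpa using hw)]
    simpa using Metric.infDist_nonneg
  · rw [List.getD_eq_default _ _ (by simpa using not_lt.1 hw)]

theorem sortedDist_getD_antitone {d n : ℕ} (y : Fin n → EuclideanSpace ℝ (Fin d))
    (C : Finset (EuclideanSpace ℝ (Fin d))) :
    Antitone fun w => (sortedDist (Finset.univ.val.map y) C).getD w 0 := by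
  intro a b hab
  by_cases hb : b < n
  · obtain ⟨σ, hσ, hs⟩ := exists_perm_sortedDist y C
    have ha := hab.trans_lt hb
    simp only [hs]
    rw [List.getD_eq_getElem _ _ (by simpa using hb), List.getD_eq_getElem _ _ (by simpa using ha)]
    simpa using hσ (show (⟨a, ha⟩ : Fin n) ≤ ⟨b, hb⟩ from hab)
  · have : (sortedDist (Finset.univ.val.map y) C).getD b 0 = 0 := by
      refine List.getD_eq_default _ _ ?_
      simpa [sortedDist] using not_lt.1 hb
    simp only [this]
    exact sortedDist_getD_nonneg y C a

/-- Since `i / 2 ≤ i`, the weight `v i` may be raised to `v (i / 2)`; then each index `j` is hit by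
at most the two values `2 j` and `2 j + 1`. -/
theorem sum_mul_half_le {n : ℕ} (v : Fin n → ℝ) (hv : Antitone v) (hv0 : ∀ i, 0 ≤ v i)
    (a : ℕ → ℝ) (ha : ∀ i, 0 ≤ a i) :
    ∑ i : Fin n, v i * a (i / 2) ≤ 2 * ∑ i : Fin n, v i * a i := by
  have hhalf : ∀ i : Fin n, (i : ℕ) / 2 < n := fun i => (Nat.div_le_self _ _).trans_lt i.2
  calc ∑ i : Fin n, v i * a (i / 2)
      ≤ ∑ i : Fin n, v ⟨i / 2, hhalf i⟩ * a (i / 2) := by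
        refine Finset.sum_le_sum fun i _ => mul_le_mul_of_nonneg_right (hv ?_) (ha _)
        exact Nat.div_le_self _ _
    _ = ∑ j : Fin n, ∑ i ∈ Finset.univ.filter fun i : Fin n => (⟨i / 2, hhalf i⟩ : Fin n) = j,
          v ⟨i / 2, hhalf i⟩ * a (i / 2) :=
        (Finset.sum_fiberwise _ _ _).symm
    _ ≤ ∑ j : Fin n, 2 * (v j * a j) := by
        refine Finset.sum_le_sum fun j _ => ?_
        calc _ = ∑ i ∈ Finset.univ.filter fun i : Fin n => (⟨i / 2, hhalf i⟩ : Fin n) = j,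
                v j * a j := by
              refine Finset.sum_congr rfl fun i hi => ?_
              simp only [Finset.mem_filter, Finset.mem_univ, true_and] at hi
              rw [← hi]
          _ ≤ _ := by
              rw [Finset.sum_const, nsmul_eq_mul]
              refine mul_le_mul_of_nonneg_right ?_ (mul_nonneg (hv0 _) (ha _))
              have : ((Finset.univ.filter fun i : Fin n =>
                  (⟨i / 2, hhalf i⟩ : Fin n) = j).map Fin.valEmbedding).card ≤
                  ({2 * (j : ℕ), 2 * (j : ℕ) + 1} : Finset ℕ).card := by
                refine Finset.card_le_card fun i hi => ?_
                simp only [Finset.mem_map, Finset.mem_filter, Finset.mem_univ, true_and,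
                  Fin.ext_iff, Fin.valEmbedding_apply] at hi
                obtain ⟨i, hi, rfl⟩ := hi
                simp only [Finset.mem_insert, Finset.mem_singleton]
                omega
              rw [Finset.card_map] at this
              exact_mod_cast this.trans Finset.card_le_two
    _ = _ := by rw [Finset.mul_sum]

/-- If at most `w` indices have `u`-value at most `w`, for every `w`, then weighting an antitone
function of `u` in any order is dominated by weighting it in the order `0, 1, 2, …`. -/
theorem sum_mul_comp_le_of_card_le {n : ℕ} (v : Fin n → ℝ) (hv : Antitone v)
    (hv0 : ∀ i, 0 ≤ v i) (u : Fin n → ℕ) (f : ℕ → ℝ) (hf : Antitone f)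
    (hu : ∀ w, (Finset.univ.filter fun i => u i ≤ w).card ≤ w) (σ : Equiv.Perm (Fin n)) :
    ∑ i, v i * f (u (σ i)) ≤ ∑ i : Fin n, v i * f i := by
  let τ := Tuple.sort u
  have hτ : Monotone (u ∘ τ) := Tuple.monotone_sort u
  calc ∑ i, v i * f (u (σ i)) ≤ ∑ i, v i * f (u (τ i)) := by
        have := Monovary.sum_mul_comp_perm_le_sum_mul (σ := σ.trans τ.symm)
          (hv.monovary (hf.comp_monotone hτ))
        simpa using this
    _ ≤ _ := by
        refine Finset.sum_le_sum fun i _ => mul_le_mul_of_nonneg_left (hf ?_) (hv0 i)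
        -- In increasing order of `u`, at least `i + 1` indices have `u`-value at most `u (τ i)`;
        -- hence `i ≤ u (τ i)` by `hu`.
        have h1 : ((Finset.univ.filter fun j : Fin n => j ≤ i).map τ.toEmbedding).card ≤
            (Finset.univ.filter fun l => u l ≤ u (τ i)).card := by
          refine Finset.card_le_card fun l hl => ?_
          simp only [Finset.mem_map, Finset.mem_filter, Finset.mem_univ, true_and] at hl ⊢
          obtain ⟨j, hj, rfl⟩ := hl
          exact hτ hj
        have h2 : (Finset.univ.filter fun j : Fin n => j ≤ i).card = i + 1 := by
          have : (Finset.univ.filter fun j : Fin n => j ≤ i) = Finset.Iic i := by ext; simp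
          rw [this, Fin.card_Iic]
        rw [Finset.card_map, h2] at h1
        exact (Nat.le_succ _).trans (h1.trans (hu _))

/-! ### Peeling by smallest heavy balls. -/

/-- The squared distance of two points of an indexed family. -/
def sqDist {d n : ℕ} (x : Fin n → EuclideanSpace ℝ (Fin d)) (i j : Fin n) : ℝ :=
  dist (x i) (x j) ^ 2

theorem sqDist_nonneg {d n : ℕ} (x : Fin n → EuclideanSpace ℝ (Fin d)) (i j : Fin n) :
    0 ≤ sqDist x i j := sq_nonneg _

/-- The points of `U` in the ball around `x a` with `x b` on its boundary. -/
def ballIn {d n : ℕ} (x : Fin n → EuclideanSpace ℝ (Fin d)) (U : Finset (Fin n))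
    (a b : Fin n) : Finset (Fin n) :=
  U.filter fun l => sqDist x a l ≤ sqDist x a b

/-- The ball around `x a` through `x b` contains at least a `1 / (2 k)` fraction of `U`. -/
def Heavy {d n : ℕ} (x : Fin n → EuclideanSpace ℝ (Fin d)) (k : ℕ) (U : Finset (Fin n))
    (a b : Fin n) : Prop :=
  a ∈ U ∧ b ∈ U ∧ U.card ≤ 2 * k * (ballIn x U a b).card

/-- The record of a peeling process that has removed smallest heavy balls in `N` rounds until the
set `U` was left: `m i` is the squared radius of the ball in which `i` was removed, `ctr i` its
center, `col i` the number of the round, and `u i` the number of points left before that round. -/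
structure PeelRecord {d n : ℕ} (x : Fin n → EuclideanSpace ℝ (Fin d)) (k : ℕ)
    (U : Finset (Fin n)) (m : Fin n → ℝ) (N : ℕ) (u col : Fin n → ℕ)
    (ctr : Fin n → EuclideanSpace ℝ (Fin d)) : Prop where
  -- `Real.log 0 = 0`, so the logarithm does not register the round that empties `U`; the extra `1`
  -- pays for it.
  rounds : (N : ℝ) ≤ 2 * k * (Real.log n - Real.log U.card) + if U = ∅ then 1 else 0
  col_lt : ∀ i ∉ U, col i < N
  col_eq : ∀ i ∉ U, ∀ j ∉ U, col i = col j → m i = m j ∧ ctr i = ctr j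
  nonneg : ∀ i ∉ U, 0 ≤ m i
  dist_ctr : ∀ i ∉ U, dist (x i) (ctr i) ^ 2 ≤ m i
  -- The comparison with arbitrary centers: the peeling radius is at most twice any `r` that leaves
  -- out no more than half as many points as were present.
  le_opt : ∀ i ∉ U, ∀ C : Finset (EuclideanSpace ℝ (Fin d)), C.card = k → ∀ r : ℝ, 0 ≤ r →
    (Finset.univ.filter fun l =>
      r < Metric.infDist (x l) (C : Set (EuclideanSpace ℝ (Fin d)))).card ≤ u i / 2 →
    m i ≤ (2 * r) ^ 2
  -- All points counted here, and all of `U`, were present before the earliest round with `u ≤ w`.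
  -- Without such a round the bound could fail, because `U` may have more than `w` points.
  card_le : ∀ w, (∃ i ∉ U, u i ≤ w) →
    (Finset.univ.filter fun i => i ∉ U ∧ u i ≤ w).card + U.card ≤ w

/-- `U` and `m` are the outcome of a peeling process. -/
def Peeled {d n : ℕ} (x : Fin n → EuclideanSpace ℝ (Fin d)) (k : ℕ)
    (U : Finset (Fin n)) (m : Fin n → ℝ) : Prop :=
  ∃ N u col ctr, PeelRecord x k U m N u col ctr

/-- Start of the peeling. All conditions on points concern `i ∉ U`, so `m` and the witnesses are
arbitrary. -/
theorem peeled_univ {d n : ℕ} (hn : 1 ≤ n) (x : Fin n → EuclideanSpace ℝ (Fin d)) (k : ℕ)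
    (m : Fin n → ℝ) : Peeled x k Finset.univ m := by
  refine ⟨0, fun _ => 0, fun _ => 0, x, ?_, ?_, ?_, ?_, ?_, ?_, ?_⟩
  · have : ¬ (Finset.univ : Finset (Fin n)) = ∅ := by
      have : Nonempty (Fin n) := ⟨⟨0, hn⟩⟩
      exact Finset.univ_nonempty.ne_empty
    simp [this]
  all_goals simp

/-- If all but half of `U` lies within distance `r` of `k` centers, then there is a heavy ball of
radius at most `2 r`. -/
theorem exists_heavy_le {d n : ℕ} (x : Fin n → EuclideanSpace ℝ (Fin d)) {k : ℕ} (hk : 1 ≤ k)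
    {U : Finset (Fin n)} (hU : U.Nonempty) (C : Finset (EuclideanSpace ℝ (Fin d)))
    (hC : C.card = k) (r : ℝ)
    (hout : (Finset.univ.filter fun l =>
      r < Metric.infDist (x l) (C : Set (EuclideanSpace ℝ (Fin d)))).card ≤ U.card / 2) :
    ∃ a b, Heavy x k U a b ∧ sqDist x a b ≤ (2 * r) ^ 2 := by
  classical
  have hCne : C.Nonempty := Finset.card_pos.1 (by omega)
  set W := U.filter fun l => ¬ r < Metric.infDist (x l) (C : Set (EuclideanSpace ℝ (Fin d)))
    with hW
  have hWcard : U.card ≤ 2 * W.card := by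
    have h1 := Finset.card_filter_add_card_filter_not (s := U)
      (fun l => r < Metric.infDist (x l) (C : Set (EuclideanSpace ℝ (Fin d))))
    have h2 : (U.filter fun l =>
        r < Metric.infDist (x l) (C : Set (EuclideanSpace ℝ (Fin d)))).card ≤ _ :=
      Finset.card_le_card (Finset.filter_subset_filter _ (Finset.subset_univ U))
    have h3 : W.card = _ := congrArg Finset.card (Finset.filter_congr_decidable _ _ _)
    omega
  have hnear : ∀ l, ∃ c ∈ C, Metric.infDist (x l) (C : Set (EuclideanSpace ℝ (Fin d))) =
      dist (x l) c := by
    intro l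
    obtain ⟨c, hc, h⟩ := C.finite_toSet.isCompact.exists_infDist_eq_dist
      (Finset.coe_nonempty.2 hCne) (x l)
    exact ⟨c, hc, h⟩
  choose c hcC hc using hnear
  -- Pigeonhole over the nearest centers: some center is nearest to at least a `1 / k` fraction of
  -- `W`, hence to a `1 / (2k)` fraction of `U`.
  obtain ⟨e, heC, he⟩ : ∃ e ∈ C, W.card ≤ C.card * (W.filter fun l => c l = e).card := by
    by_contra! hcon
    have h1 : W.card = ∑ e ∈ C, (W.filter fun l => c l = e).card :=
      Finset.card_eq_sum_card_fiberwise fun l _ => hcC l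
    have h2 : ∑ e ∈ C, C.card * (W.filter fun l => c l = e).card < ∑ e ∈ C, W.card :=
      Finset.sum_lt_sum_of_nonempty hCne hcon
    rw [← Finset.mul_sum, ← h1, Finset.sum_const, smul_eq_mul] at h2
    exact lt_irrefl _ h2
  set Z := W.filter fun l => c l = e with hZ
  have hUpos : 0 < U.card := hU.card_pos
  have hZne : Z.Nonempty := by
    rw [Finset.nonempty_iff_ne_empty]
    intro h
    have : W.card = 0 := by simpa [h] using he
    omega
  have hZd : ∀ l ∈ Z, dist (x l) e ≤ r := by
    intro l hl
    simp only [hZ, hW, Finset.mem_filter, not_lt] at hl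
    rw [← hl.2, ← hc l]
    exact hl.1.2
  have hZU : Z ⊆ U := (Finset.filter_subset _ _).trans (Finset.filter_subset _ _)
  obtain ⟨a, ha⟩ := hZne
  -- With `b` farthest from `a` inside the cluster, the ball around `a` through `b` contains the
  -- whole cluster, and both points are within `r` of the center `e`.
  obtain ⟨b, hb, hmax⟩ := Finset.exists_max_image Z (fun l => sqDist x a l) ⟨a, ha⟩
  refine ⟨a, b, ⟨hZU ha, hZU hb, ?_⟩, ?_⟩
  · have hsub : Z ⊆ ballIn x U a b := fun l hl =>
      Finset.mem_filter.2 ⟨hZU hl, hmax l hl⟩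
    have h2 := Finset.card_le_card hsub
    calc U.card ≤ 2 * W.card := hWcard
      _ ≤ 2 * (k * (ballIn x U a b).card) := by
          rw [hC] at he
          exact Nat.mul_le_mul_left _ (he.trans (Nat.mul_le_mul_left _ h2))
      _ = _ := by ring
  · unfold sqDist
    have h1 : dist (x a) (x b) ≤ dist (x a) e + dist (x b) e := dist_triangle_right _ _ _
    have := hZd a ha
    have := hZd b hb
    exact pow_le_pow_left₀ dist_nonneg (by linarith) 2

/-- Ensures that the search never fails: around any point, the ball through the farthest point
contains all of `U`. -/
theorem exists_heavy {d n : ℕ} (x : Fin n → EuclideanSpace ℝ (Fin d)) {k : ℕ} (hk : 1 ≤ k)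
    {U : Finset (Fin n)} (hU : U.Nonempty) : ∃ a b, Heavy x k U a b := by
  obtain ⟨a, ha⟩ := hU
  obtain ⟨b, hb, hmax⟩ := Finset.exists_max_image U (fun l => sqDist x a l) ⟨a, ha⟩
  refine ⟨a, b, ha, hb, ?_⟩
  have : ballIn x U a b = U := Finset.filter_true_of_mem hmax
  rw [this]
  exact Nat.le_mul_of_pos_left _ (by omega)

/-- One round of peeling. -/
theorem Peeled.step {d n : ℕ} {x : Fin n → EuclideanSpace ℝ (Fin d)} {k : ℕ} (hk : 1 ≤ k)
    {U : Finset (Fin n)} {m : Fin n → ℝ} (h : Peeled x k U m) {a b : Fin n}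
    (hab : Heavy x k U a b) (hmin : ∀ a' b', Heavy x k U a' b' → sqDist x a b ≤ sqDist x a' b')
    {m' : Fin n → ℝ} (hm : ∀ i ∉ U, m' i = m i) (hm' : ∀ i ∈ ballIn x U a b, m' i = sqDist x a b) :
    Peeled x k (U \ ballIn x U a b) m' := by
  classical
  obtain ⟨N, u, col, ctr, h⟩ := h
  set R := ballIn x U a b with hR
  have hRU : R ⊆ U := Finset.filter_subset _ _
  have hUne : U.Nonempty := ⟨a, hab.1⟩
  have hcases : ∀ i, i ∉ U \ R → i ∈ R ∨ (i ∉ U ∧ i ∉ R) := by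
    intro i hi
    by_cases hiR : i ∈ R
    · exact Or.inl hiR
    · exact Or.inr ⟨fun hiU => hi (Finset.mem_sdiff.2 ⟨hiU, hiR⟩), hiR⟩
  have hcard : (U \ R).card + R.card = U.card := Finset.card_sdiff_add_card_eq_card hRU
  refine ⟨N + 1, fun i => if i ∈ R then U.card else u i, fun i => if i ∈ R then N else col i,
    fun i => if i ∈ R then x a else ctr i, ?_, ?_, ?_, ?_, ?_, ?_, ?_⟩
  · have h1 := h.rounds
    rw [if_neg hUne.ne_empty] at h1
    push_cast
    by_cases hemp : U \ R = ∅
    · rw [if_pos hemp, hemp]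
      have h2 : 0 ≤ Real.log U.card := Real.log_natCast_nonneg _
      have h3 : (0 : ℝ) ≤ 2 * k := by positivity
      simp only [Finset.card_empty, Nat.cast_zero, Real.log_zero]
      nlinarith
    · rw [if_neg hemp]
      have hpos : (0 : ℝ) < (U \ R).card := by
        exact_mod_cast (Finset.nonempty_iff_ne_empty.2 hemp).card_pos
      have hUpos : (0 : ℝ) < U.card := by exact_mod_cast hUne.card_pos
      have hkpos : (0 : ℝ) < k := by exact_mod_cast hk
      -- The logarithm of `|U|` drops by at least `|R| / |U| ≥ 1 / (2k)`, which pays for one round.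
      have h2 : Real.log ((U \ R).card / U.card) ≤ (U \ R).card / U.card - 1 :=
        Real.log_le_sub_one_of_pos (by positivity)
      rw [Real.log_div hpos.ne' hUpos.ne'] at h2
      have h3 : ((U \ R).card : ℝ) + R.card = U.card := by exact_mod_cast hcard
      have h4 : (U.card : ℝ) ≤ 2 * k * R.card := by exact_mod_cast hab.2.2
      have h5 : ((U \ R).card : ℝ) / U.card - 1 = - (R.card / U.card) := by
        rw [← h3] at hUpos ⊢
        field_simp
        ring
      have h6 : 1 ≤ 2 * (k : ℝ) * (R.card / U.card) := by
        rw [← mul_div_assoc, le_div_iff₀ hUpos]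
        linarith
      nlinarith
  · intro i hi
    rcases hcases i hi with hiR | ⟨hiU, hiR⟩
    · simp [hiR]
    · simp only [hiR, if_false]
      exact (h.col_lt i hiU).trans (Nat.lt_succ_self _)
  · intro i hi j hj hij
    rcases hcases i hi with hiR | ⟨hiU, hiR⟩ <;> rcases hcases j hj with hjR | ⟨hjU, hjR⟩
    · simp [hiR, hjR, hm' i hiR, hm' j hjR]
    · simp only [hiR, hjR, if_true, if_false] at hij
      have := h.col_lt j hjU
      omega
    · simp only [hiR, hjR, if_true, if_false] at hij
      have := h.col_lt i hiU
      omega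
    · simp only [hiR, hjR, if_false] at hij ⊢
      rw [hm i hiU, hm j hjU]
      exact h.col_eq i hiU j hjU hij
  · intro i hi
    rcases hcases i hi with hiR | ⟨hiU, hiR⟩
    · rw [hm' i hiR]
      exact sqDist_nonneg _ _ _
    · rw [hm i hiU]
      exact h.nonneg i hiU
  · intro i hi
    rcases hcases i hi with hiR | ⟨hiU, hiR⟩
    · simp only [hiR, if_true, hm' i hiR]
      rw [dist_comm]
      exact (Finset.mem_filter.1 hiR).2
    · simp only [hiR, if_false, hm i hiU]
      exact h.dist_ctr i hiU
  · intro i hi C hC r hr hout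
    rcases hcases i hi with hiR | ⟨hiU, hiR⟩
    · simp only [hiR, if_true] at hout
      rw [hm' i hiR]
      obtain ⟨a', b', hab', hle⟩ := exists_heavy_le x hk hUne C hC r hout
      exact (hmin a' b' hab').trans hle
    · simp only [hiR, if_false] at hout
      rw [hm i hiU]
      exact h.le_opt i hiU C hC r hr hout
  · rintro w ⟨i, hi, hiw⟩
    -- If `w < |U|`, the new points do not count and the old bound suffices. Otherwise either an
    -- older point counts and the old bound already includes `U`, or only points of `R` count and
    -- `|R| + |U \ R| = |U| ≤ w`.
    by_cases hw : U.card ≤ w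
    · have hsub : (Finset.univ.filter fun j => j ∉ U \ R ∧ (if j ∈ R then U.card else u j) ≤ w) ⊆
          (Finset.univ.filter fun j => j ∉ U ∧ u j ≤ w) ∪ R := by
        intro j hj
        simp only [Finset.mem_filter, Finset.mem_univ, true_and, Finset.mem_union] at hj ⊢
        rcases hcases j hj.1 with hjR | ⟨hjU, hjR⟩
        · exact Or.inr hjR
        · simp only [hjR, if_false] at hj
          exact Or.inl ⟨hjU, hj.2⟩
      have h1 := (Finset.card_le_card hsub).trans (Finset.card_union_le _ _)
      by_cases hne : ∃ i ∉ U, u i ≤ w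
      · have := h.card_le w hne
        omega
      · have h2 : (Finset.univ.filter fun j => j ∉ U ∧ u j ≤ w) = ∅ := by
          rw [Finset.filter_eq_empty_iff]
          intro j _ hj
          exact hne ⟨j, hj⟩
        rw [h2, Finset.card_empty] at h1
        omega
    · rcases hcases i hi with hiR | ⟨hiU, hiR⟩
      · simp only [hiR, if_true] at hiw
        exact absurd hiw hw
      · simp only [hiR, if_false] at hiw
        have := h.card_le w ⟨i, hiU, hiw⟩
        omega

/-! ### The cost error of moving the points. -/

/-- A family of points that is close to `x` relative to the peeling radii is a coreset. -/
theorem Peeled.isSimultaneousCoreset {d n : ℕ} {x : Fin n → EuclideanSpace ℝ (Fin d)} {k : ℕ}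
    {m : Fin n → ℝ} (h : Peeled x k ∅ m) {ε : ℝ} (hε : 0 < ε)
    (y : Fin n → EuclideanSpace ℝ (Fin d))
    (hy : ∀ i, dist (x i) (y i) ^ 2 ≤ ε ^ 2 / 16 * m i) :
    IsSimultaneousCoreset k ε (Finset.univ.val.map x) (Finset.univ.val.map y) := by
  obtain ⟨N, u, col, ctr, h⟩ := h
  refine ⟨by simp, fun C hC v hv hv0 => ?_⟩
  have hn : (Finset.univ.val.map x).card = n := by simp
  -- The type of `v` contains the cardinality, so `v` must be generalized before the cardinality is
  -- rewritten to `n`.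
  revert v
  rw [hn]
  intro v hv hv0
  set s := fun w => (sortedDist (Finset.univ.val.map x) C).getD w 0 with hs
  have hs0 : ∀ w, 0 ≤ s w := sortedDist_getD_nonneg x C
  have hmove : ∀ i, dist (x i) (y i) ≤ ε / 2 * s (u i / 2) := by
    intro i
    -- The sorted entry at position `u i / 2` leaves out at most `u i / 2` points, which is what
    -- `le_opt` asks. So `√(m i) ≤ 2 * s (u i / 2)`, and `ε / 4` becomes `ε / 2`.
    have h1 := h.le_opt i (Finset.notMem_empty i) C hC (s (u i / 2)) (hs0 _)
      (card_lt_infDist_le x C _)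
    refine abs_le_of_sq_le_sq' ?_ (mul_nonneg (by positivity) (hs0 _)) |>.2
    calc _ ≤ ε ^ 2 / 16 * m i := hy i
      _ ≤ ε ^ 2 / 16 * (2 * s (u i / 2)) ^ 2 := by gcongr
      _ = (ε / 4 * s (u i / 2) * 2) ^ 2 := by ring
      _ ≤ _ := by
        apply le_of_eq
        ring
  have herr : ∀ σ : Equiv.Perm (Fin n), ∑ i, v i * dist (x (σ i)) (y (σ i)) ≤
      ε * cost v (Finset.univ.val.map x) C := by
    intro σ
    calc ∑ i, v i * dist (x (σ i)) (y (σ i)) ≤ ∑ i, v i * (ε / 2 * s (u (σ i) / 2)) :=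
          Finset.sum_le_sum fun i _ => mul_le_mul_of_nonneg_left (hmove _) (hv0 i)
      _ = ε / 2 * ∑ i, v i * s (u (σ i) / 2) := by
          rw [Finset.mul_sum]
          exact Finset.sum_congr rfl fun i _ => by ring
      _ ≤ ε / 2 * ∑ i : Fin n, v i * s (i / 2) := by
          refine mul_le_mul_of_nonneg_left ?_ (by positivity)
          refine sum_mul_comp_le_of_card_le v hv hv0 u (fun w => s (w / 2)) ?_ ?_ σ
          · exact (sortedDist_getD_antitone x C).comp_monotone fun a b hab =>
              Nat.div_le_div_right hab
          · intro w
            by_cases hw : ∃ i ∉ (∅ : Finset (Fin n)), u i ≤ w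
            · simpa using h.card_le w hw
            · have : (Finset.univ.filter fun i => u i ≤ w) = ∅ := by
                rw [Finset.filter_eq_empty_iff]
                intro j _ hj
                exact hw ⟨j, Finset.notMem_empty j, hj⟩
              simp [this]
      _ ≤ ε / 2 * (2 * ∑ i : Fin n, v i * s i) := by
          refine mul_le_mul_of_nonneg_left ?_ (by positivity)
          exact sum_mul_half_le v hv hv0 s hs0
      _ = _ := by
          unfold cost
          ring
  obtain ⟨⟨σ, hσ⟩, hxmax⟩ := exists_perm_cost x C v
  obtain ⟨⟨τ, hτ⟩, hymax⟩ := exists_perm_cost y C v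
  constructor
  -- The order that sorts `x` need not sort `y`, but the cost of `y` is the maximum over all orders;
  -- the other bound exchanges the roles.
  · have h1 : cost v (Finset.univ.val.map x) C ≤
        ∑ i, v i * Metric.infDist (y (σ i)) (C : Set (EuclideanSpace ℝ (Fin d))) +
        ∑ i, v i * dist (x (σ i)) (y (σ i)) := by
      rw [hσ, ← Finset.sum_add_distrib]
      refine Finset.sum_le_sum fun i _ => ?_
      rw [← mul_add]
      exact mul_le_mul_of_nonneg_left Metric.infDist_le_infDist_add_dist (hv0 i)
    linarith [hymax hv σ, herr σ]
  · have h1 : cost v (Finset.univ.val.map y) C ≤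
        ∑ i, v i * Metric.infDist (x (τ i)) (C : Set (EuclideanSpace ℝ (Fin d))) +
        ∑ i, v i * dist (x (τ i)) (y (τ i)) := by
      rw [hτ, ← Finset.sum_add_distrib]
      refine Finset.sum_le_sum fun i _ => ?_
      rw [← mul_add, dist_comm]
      exact mul_le_mul_of_nonneg_left Metric.infDist_le_infDist_add_dist (hv0 i)
    linarith [hxmax hv τ, herr τ]

/-! ### The size bound. -/

/-- A set of indices that is separated relative to the peeling radii is small. -/
theorem Peeled.card_le {d n : ℕ} (hn : 2 ≤ n) (hd : 1 ≤ d) {x : Fin n → EuclideanSpace ℝ (Fin d)}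
    (hx : Function.Injective x) {k : ℕ} (hk : 1 ≤ k)
    {m : Fin n → ℝ} (h : Peeled x k ∅ m) {ε : ℝ} (hε : 0 < ε) (hε1 : ε < 1) (S : Finset (Fin n))
    (hS : ∀ i ∈ S, ∀ j ∈ S, i < j → ε ^ 2 / 16 * m j < sqDist x i j) :
    (S.card : ℝ) ≤ 54 ^ d * ((k : ℝ) ^ 2 * Real.log n ^ 2 / ε ^ d) := by
  classical
  obtain ⟨N, u, col, ctr, h⟩ := h
  have hclass : ∀ t ∈ Finset.range N, ((S.filter fun i => col i = t).card : ℝ) ≤ (9 / ε) ^ d := by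
    intro t _
    set Z := S.filter fun i => col i = t with hZ
    -- Covers the degenerate classes: empty ones, and those of radius `0`, which by injectivity
    -- contain at most one point.
    have h1 : (1 : ℝ) ≤ (9 / ε) ^ d := one_le_pow₀ (by rw [le_div_iff₀ hε]; linarith)
    rcases Z.eq_empty_or_nonempty with hemp | ⟨a, ha⟩
    · rw [hemp]
      simp only [Finset.card_empty, Nat.cast_zero]
      linarith
    have hZS : ∀ i ∈ Z, i ∈ S ∧ m i = m a ∧ ctr i = ctr a := by
      intro i hi
      rw [hZ, Finset.mem_filter] at hi ha
      exact ⟨hi.1, h.col_eq i (Finset.notMem_empty i) a (Finset.notMem_empty a)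
        (hi.2.trans ha.2.symm)⟩
    have hma := h.nonneg a (Finset.notMem_empty a)
    set g := √(m a) with hg
    have hg2 : g ^ 2 = m a := Real.sq_sqrt hma
    have hball : ∀ i ∈ Z, dist (x i) (ctr a) ≤ g := by
      intro i hi
      have h2 := h.dist_ctr i (Finset.notMem_empty i)
      rw [(hZS i hi).2.1, (hZS i hi).2.2] at h2
      exact Real.le_sqrt_of_sq_le h2
    -- The separation hypothesis uses the radius of the later index only; inside one class all radii
    -- agree, so it becomes symmetric.
    have hsep : ∀ i ∈ Z, ∀ j ∈ Z, i ≠ j → ε / 4 * g ≤ dist (x i) (x j) := by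
      have hlt : ∀ i ∈ Z, ∀ j ∈ Z, i < j → ε / 4 * g ≤ dist (x i) (x j) := by
        intro i hi j hj hij
        have h2 := hS i (hZS i hi).1 j (hZS j hj).1 hij
        rw [(hZS j hj).2.1, ← hg2] at h2
        refine (abs_le_of_sq_le_sq' ?_ dist_nonneg).2
        unfold sqDist at h2
        linarith [show (ε / 4 * g) ^ 2 = ε ^ 2 / 16 * g ^ 2 by ring]
      intro i hi j hj hij
      rcases lt_or_gt_of_ne hij with hij | hij
      · exact hlt i hi j hj hij
      · rw [dist_comm]
        exact hlt j hj i hi hij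
    have hg0 : 0 ≤ g := Real.sqrt_nonneg _
    rcases hg0.eq_or_lt with hg0 | hgpos
    · have hone : Z.card ≤ 1 := by
        rw [Finset.card_le_one]
        intro i hi j hj
        have h3 := hball i hi
        have h4 := hball j hj
        rw [← hg0] at h3 h4
        exact hx ((dist_le_zero.1 h3).trans (dist_le_zero.1 h4).symm)
      have : (Z.card : ℝ) ≤ 1 := by exact_mod_cast hone
      linarith
    · have hpack := card_le_of_pairwise_le_dist (Z.map ⟨x, hx⟩) (ctr a) hgpos.le
        (show 0 < ε / 4 * g by positivity) (by simpa using hball) (by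
          intro p hp q hq hpq
          simp only [Finset.coe_map, Set.mem_image, Finset.mem_coe,
            Function.Embedding.coeFn_mk] at hp hq
          obtain ⟨i, hi, rfl⟩ := hp
          obtain ⟨j, hj, rfl⟩ := hq
          exact hsep i hi j hj fun hij => hpq (by rw [hij]))
      rw [Finset.card_map, finrank_euclideanSpace_fin] at hpack
      refine hpack.trans (pow_le_pow_left₀ (by positivity) ?_ d)
      have : 2 * g / (ε / 4 * g) = 8 / ε := by
        field_simp
        norm_num
      rw [this, le_div_iff₀ hε, add_mul, div_mul_cancel₀ _ hε.ne']
      linarith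
  have hcard : (S.card : ℝ) ≤ N * (9 / ε) ^ d := by
    have h1 : S.card = ∑ t ∈ Finset.range N, (S.filter fun i => col i = t).card :=
      Finset.card_eq_sum_card_fiberwise fun i _ => by
        simpa using h.col_lt i (Finset.notMem_empty i)
    rw [h1]
    push_cast
    refine (Finset.sum_le_sum hclass).trans ?_
    simp
  have hlog : 0.69 < Real.log n := by
    have h1 : Real.log 2 ≤ Real.log n :=
      Real.log_le_log (by norm_num) (by exact_mod_cast hn)
    linarith [Real.log_two_gt_d9]
  have hk1 : (1 : ℝ) ≤ k := by exact_mod_cast hk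
  have hN : (N : ℝ) ≤ 6 * (k ^ 2 * Real.log n ^ 2) := by
    have h1 := h.rounds
    simp only [Finset.card_empty, Nat.cast_zero, Real.log_zero, if_true, sub_zero] at h1
    -- With `y = k * log n > 0.69` one has `2 y + 1 ≤ 6 y ^ 2`; this is where the constant `6` and
    -- the squares come from.
    have h2 : 0.69 < k * Real.log n := by nlinarith
    nlinarith
  calc (S.card : ℝ) ≤ N * (9 / ε) ^ d := hcard
    _ ≤ 6 * (k ^ 2 * Real.log n ^ 2) * (9 / ε) ^ d := by gcongr
    _ ≤ 6 ^ d * (k ^ 2 * Real.log n ^ 2) * (9 / ε) ^ d := by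
        gcongr
        -- `6 ≤ 6 ^ d` needs `1 ≤ d`; then `6 ^ d * 9 ^ d = 54 ^ d`.
        exact le_self_pow₀ (by norm_num) (by omega)
    _ = _ := by
        rw [show (54 : ℝ) = 6 * 9 by norm_num, mul_pow, div_pow]
        ring

end OrderedMedian

namespace RealRAM

/-! ### Reasoning about programs -/

/-- Started in `s`, the program `p` halts after at most `T` steps in a state with property `Q`. -/
def HaltsIn (p : Prog) (s : State) (T : ℕ) (Q : State → Prop) : Prop :=
  ∃ t s', Exec p s t s' ∧ t ≤ T ∧ Q s'

theorem HaltsIn.weaken {p : Prog} {s : State} {T T' : ℕ} {Q Q' : State → Prop}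
    (h : HaltsIn p s T Q) (hT : T ≤ T') (hQ : ∀ s', Q s' → Q' s') : HaltsIn p s T' Q' := by
  obtain ⟨t, s', he, ht, hq⟩ := h
  exact ⟨t, s', he, ht.trans hT, hQ s' hq⟩

theorem HaltsIn.seq {p q : Prog} {s : State} {T T' : ℕ} {R Q : State → Prop}
    (h : HaltsIn p s T R) (h' : ∀ s', R s' → HaltsIn q s' T' Q) :
    HaltsIn (.seq p q) s (T + T') Q := by
  obtain ⟨t, s', he, ht, hr⟩ := h
  obtain ⟨t', s'', he', ht', hq⟩ := h' s' hr
  exact ⟨t + t', s'', he.seq he', add_le_add ht ht', hq⟩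

theorem HaltsIn.ite {c : Test} {p q : Prog} {s : State} {T : ℕ} {Q : State → Prop}
    (hp : c.Holds s → HaltsIn p s T Q) (hq : ¬ c.Holds s → HaltsIn q s T Q) :
    HaltsIn (.ite c p q) s (T + 1) Q := by
  by_cases hc : c.Holds s
  · obtain ⟨t, s', he, ht, h⟩ := hp hc
    exact ⟨t + 1, s', he.iteTrue hc, by omega, h⟩
  · obtain ⟨t, s', he, ht, h⟩ := hq hc
    exact ⟨t + 1, s', he.iteFalse hc, by omega, h⟩

/-- A loop whose invariant carries the number of iterations done. -/
theorem HaltsIn.for {c : Test} {p : Prog} {I : ℕ → State → Prop} {N T : ℕ}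
    (htest : ∀ i ≤ N, ∀ s, I i s → (c.Holds s ↔ i < N))
    (hbody : ∀ i < N, ∀ s, I i s → HaltsIn p s T (I (i + 1))) :
    ∀ s, I 0 s → HaltsIn (.while c p) s (N * (T + 1) + 1) (I N) := by
  intro s hs
  suffices H : ∀ j i s, i + j = N → I i s → HaltsIn (.while c p) s (j * (T + 1) + 1) (I N) from
    H N 0 s (by omega) hs
  intro j
  induction j with
  | zero =>
    intro i s hi hI
    have : i = N := by omega
    subst this
    exact ⟨1, s, .whileFalse (by rw [htest i le_rfl s hI]; omega), by omega, hI⟩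
  | succ j ih =>
    intro i s hi hI
    obtain ⟨t, s', he, ht, hI'⟩ := hbody i (by omega) s hI
    obtain ⟨t', s'', he', ht', hI''⟩ := ih (i + 1) s' (by omega) hI'
    refine ⟨t + t' + 1, s'', .whileTrue ((htest i (by omega) s hI).2 (by omega)) he he', ?_, hI''⟩
    rw [add_mul]
    omega

/-- A loop whose invariant carries an upper bound for the number of iterations to come. -/
theorem HaltsIn.while {c : Test} {p : Prog} {I : ℕ → State → Prop} {T : ℕ}
    (htest : ∀ m s, I m s → (c.Holds s ↔ 0 < m))
    (hbody : ∀ m, 0 < m → ∀ s, I m s → HaltsIn p s T fun s' => ∃ m' < m, I m' s')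
    (m : ℕ) {s : State} (hs : I m s) :
    HaltsIn (.while c p) s (m * (T + 1) + 1) (I 0) := by
  induction m using Nat.strong_induction_on generalizing s with
  | _ m ih =>
    rcases Nat.eq_zero_or_pos m with rfl | hm
    · exact ⟨1, s, .whileFalse (by simp [htest 0 s hs]), by omega, hs⟩
    · obtain ⟨t, s', he, ht, m', hm', hI'⟩ := hbody m hm s hs
      obtain ⟨t', s'', he', ht', hI''⟩ := ih m' hm' hI'
      refine ⟨t + t' + 1, s'', .whileTrue ((htest m s hs).2 hm) he he', ?_, hI''⟩
      have : (m' + 1) * (T + 1) ≤ m * (T + 1) := Nat.mul_le_mul_right _ hm'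
      rw [add_mul] at this
      omega

/-- Straight-line code. -/
def block : List Instr → Prog
  | [] => .instr .skip
  | i :: l => .seq (.instr i) (block l)

/-- The effect of straight-line code. -/
def runBlock (l : List Instr) (s : State) : State := l.foldl (fun s i => i.run s) s

theorem HaltsIn.block {l : List Instr} {s : State} {Q : State → Prop} (h : Q (runBlock l s)) :
    HaltsIn (block l) s (l.length + 1) Q := by
  induction l generalizing s with
  | nil => exact ⟨1, s, .instr .skip s, by simp, h⟩
  | cons i l ih =>
    refine (HaltsIn.seq (R := fun s' => s' = i.run s) ⟨1, _, .instr i s, le_rfl, rfl⟩ ?_).weaken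
      (T := 1 + (l.length + 1)) (by simp; omega) fun _ h => h
    rintro _ rfl
    exact ih h

/-- The two states have the same memory, and agree on the natural registers below `L` and the
real registers below `M`. -/
structure EqBelow (L M : ℕ) (s s' : State) : Prop where
  natMem : s'.natMem = s.natMem
  realMem : s'.realMem = s.realMem
  nat : ∀ a < L, s'.natReg a = s.natReg a
  real : ∀ a < M, s'.realReg a = s.realReg a

theorem EqBelow.rfl {L M : ℕ} {s : State} : EqBelow L M s s :=
  ⟨Eq.refl _, Eq.refl _, fun _ _ => Eq.refl _, fun _ _ => Eq.refl _⟩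

theorem EqBelow.trans {L M : ℕ} {s s' s'' : State} (h : EqBelow L M s s')
    (h' : EqBelow L M s' s'') : EqBelow L M s s'' :=
  ⟨h'.natMem.trans h.natMem, h'.realMem.trans h.realMem,
    fun a ha => (h'.nat a ha).trans (h.nat a ha), fun a ha => (h'.real a ha).trans (h.real a ha)⟩

theorem EqBelow.mono {L M L' M' : ℕ} {s s' : State} (h : EqBelow L M s s') (hL : L' ≤ L)
    (hM : M' ≤ M) : EqBelow L' M' s s' :=
  ⟨h.natMem, h.realMem, fun a ha => h.nat a (by omega), fun a ha => h.real a (by omega)⟩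

/-- The instruction changes neither the memory nor natural registers below `L` nor real registers
below `M`. -/
def Instr.Keeps (L M : ℕ) : Instr → Prop
  | .skip => True
  | .natConst a _ => L ≤ a
  | .natAdd a _ _ => L ≤ a
  | .natSub a _ _ => L ≤ a
  | .natLoad a _ => L ≤ a
  | .natStore _ _ => False
  | .realConst a _ => M ≤ a
  | .realAdd a _ _ => M ≤ a
  | .realSub a _ _ => M ≤ a
  | .realMul a _ _ => M ≤ a
  | .realDiv a _ _ => M ≤ a
  | .realLoad a _ => M ≤ a
  | .realStore _ _ => False

theorem Instr.Keeps.eqBelow {L M : ℕ} {i : Instr} (h : i.Keeps L M) (s : State) :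
    EqBelow L M s (i.run s) := by
  cases i
  case natStore => exact h.elim
  case realStore => exact h.elim
  all_goals
    refine ⟨rfl, rfl, fun a ha => ?_, fun a ha => ?_⟩ <;>
    first
      | rfl
      | exact Function.update_of_ne (ne_of_lt (lt_of_lt_of_le ha h)) _ _

theorem EqBelow.runBlock {L M : ℕ} {l : List Instr} (h : ∀ i ∈ l, i.Keeps L M) (s : State) :
    EqBelow L M s (runBlock l s) := by
  induction l generalizing s with
  | nil => exact EqBelow.rfl
  | cons i l ih =>
    exact ((h i (by simp)).eqBelow s).trans (ih (fun j hj => h j (by simp [hj])) _)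

/-! ### Squared distances -/

/-- Puts the squared distance of the points at the addresses in the registers `pa`, `pb` into the
real register `res`. -/
def distProg (pa pb res : ℕ) : Prog :=
  .seq (block [.natConst 40 0, .natAdd 41 pa 9, .natAdd 42 pb 9, .realConst res 0])
    (.while (.natLe 40 5) (block [.realLoad 40 41, .realLoad 41 42, .realSub 40 40 41,
      .realMul 40 40 40, .realAdd res res 40, .natAdd 41 41 3, .natAdd 42 42 3, .natAdd 40 40 3]))

/-- Registers from `40` on are scratch space. The first two conclusions together say that below `40`
only the real register `res` changes. -/
theorem distProg_spec {d : ℕ} (p q : EuclideanSpace ℝ (Fin d)) {pa pb res : ℕ} (hpa : pa < 40)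
    (hpb : pb < 40) (hres : res < 40) {s : State} (h3 : s.natReg 3 = 1) (h5 : s.natReg 5 + 1 = d)
    (h9 : s.natReg 9 = 0) (hp : ∀ j : Fin d, s.realMem (s.natReg pa + j) = p j)
    (hq : ∀ j : Fin d, s.realMem (s.natReg pb + j) = q j) :
    HaltsIn (distProg pa pb res) s (10 * d + 6) fun s' =>
      EqBelow 40 res s s' ∧ (∀ a, res < a → a < 40 → s'.realReg a = s.realReg a) ∧
        s'.realReg res = dist p q ^ 2 := by
  let f : ℕ → ℝ := fun j => if h : j < d then (p ⟨j, h⟩ - q ⟨j, h⟩) ^ 2 else 0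
  let I : ℕ → State → Prop := fun i s' =>
    EqBelow 40 res s s' ∧ (∀ a, res < a → a < 40 → s'.realReg a = s.realReg a) ∧
      s'.natReg 40 = i ∧ s'.natReg 41 = s.natReg pa + i ∧ s'.natReg 42 = s.natReg pb + i ∧
      s'.realReg res = ∑ j ∈ Finset.range i, f j
  have hfor := HaltsIn.for (c := .natLe 40 5) (I := I) (N := d) (T := 9)
    (p := block [.realLoad 40 41, .realLoad 41 42, .realSub 40 40 41,
      .realMul 40 40 40, .realAdd res res 40, .natAdd 41 41 3, .natAdd 42 42 3, .natAdd 40 40 3])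
    (by
      rintro i - s' ⟨he, -, h40, -⟩
      simp only [Test.Holds, h40, he.nat 5 (by norm_num)]
      omega)
    (by
      rintro i hi s' ⟨he, hr, h40, h41, h42, hsum⟩
      apply HaltsIn.block
      have h3' : s'.natReg 3 = 1 := by rw [he.nat 3 (by norm_num), h3]
      refine ⟨he.trans (EqBelow.runBlock (by simp [Instr.Keeps]; omega) _), ?_, ?_, ?_, ?_, ?_⟩
      · intro a ha ha'
        rw [← hr a ha ha']
        simp [runBlock, Instr.run, Function.update_apply, show a ≠ 40 by omega,
          show a ≠ 41 by omega, show a ≠ res by omega]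
      · simp [runBlock, Instr.run, Function.update_apply, h40, h3']
      · simp [runBlock, Instr.run, Function.update_apply, h41, h3', add_assoc]
      · simp [runBlock, Instr.run, Function.update_apply, h42, h3', add_assoc]
      · have e1 := hp ⟨i, hi⟩
        have e2 := hq ⟨i, hi⟩
        rw [← he.realMem] at e1 e2
        simp only [] at e1 e2
        rw [Finset.sum_range_succ, ← hsum]
        simp [runBlock, Instr.run, h41, h42, show res ≠ 40 by omega,
          show res ≠ 41 by omega, e1, e2, f, hi, sq])
  refine (HaltsIn.seq (R := I 0) (HaltsIn.block ?_) fun s' hs' => hfor s' hs').weaken ?_ ?_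
  · refine ⟨EqBelow.runBlock (by simp [Instr.Keeps]) _, ?_, ?_, ?_, ?_, ?_⟩
    · intro a ha ha'
      simp [runBlock, Instr.run, Function.update_apply, show a ≠ res by omega]
    all_goals simp [runBlock, Instr.run, h9, show pa ≠ 40 by omega,
      show pb ≠ 40 by omega, show pb ≠ 41 by omega]
  · simp
    omega
  · rintro s' ⟨he, hr, -, -, -, hsum⟩
    refine ⟨he, hr, ?_⟩
    rw [hsum, EuclideanSpace.dist_eq, Real.sq_sqrt (Finset.sum_nonneg fun _ _ => sq_nonneg _),
      Finset.sum_range]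
    refine Finset.sum_congr rfl fun j _ => ?_
    simp [f, Real.dist_eq, sq_abs]

/-! ### Loops over the points with flag `0` -/

/-- Runs through all points, with the index, the address and the flag of the current point in the
registers `r`, `r + 1`, `r + 2`, and executes the body for those with flag `0`. -/
def forAlive (r : ℕ) (body : Prog) : Prog :=
  .seq (block [.natConst r 0, .natConst (r + 1) 0])
    (.while (.natLe r 4)
      (.seq (block [.natLoad (r + 2) r])
        (.seq (.ite (.natLe (r + 2) 9) body (block []))
          (block [.natAdd (r + 1) (r + 1) 1, .natAdd r r 3]))))

/-- `hstable` makes the invariant blind to the loop registers from `r` on, so it survives their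
updates. The flag of a point is read before its body runs, so the body may change it. -/
theorem forAlive_spec {d n r T : ℕ} (hr : 10 ≤ r) {body : Prog} (J : ℕ → State → Prop)
    (hconst : ∀ t s, J t s →
      s.natReg 1 = d ∧ s.natReg 3 = 1 ∧ s.natReg 4 + 1 = n ∧ s.natReg 9 = 0)
    (hstable : ∀ t s s', J t s → EqBelow r 40 s s' → J t s')
    (hbody : ∀ t < n, ∀ s, J t s → s.natReg r = t → s.natReg (r + 1) = t * d → s.natMem t = 0 →
      HaltsIn body s T fun s' => J (t + 1) s' ∧ s'.natReg r = t ∧ s'.natReg (r + 1) = t * d)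
    (hskip : ∀ t < n, ∀ s, J t s → s.natMem t ≠ 0 → J (t + 1) s) :
    ∀ s, J 0 s → HaltsIn (forAlive r body) s (n * (T + 8) + 4) (J n) := by
  intro s hs
  let I : ℕ → State → Prop := fun t s => J t s ∧ s.natReg r = t ∧ s.natReg (r + 1) = t * d
  have hfor := HaltsIn.for (c := .natLe r 4) (I := I) (N := n) (T := 2 + ((T + 1 + 1) + 3))
    (p := .seq (block [.natLoad (r + 2) r])
        (.seq (.ite (.natLe (r + 2) 9) body (block []))
          (block [.natAdd (r + 1) (r + 1) 1, .natAdd r r 3])))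
    (by
      rintro t - s ⟨hJ, h, -⟩
      have := (hconst t s hJ).2.2.1
      simp only [Test.Holds, h]
      omega)
    (by
      rintro t ht s ⟨hJ, hr1, hr2⟩
      refine HaltsIn.seq (R := fun s' => I t s' ∧ s'.natReg (r + 2) = s'.natMem t)
        (HaltsIn.block ⟨⟨?_, ?_, ?_⟩, ?_⟩) ?_
      · exact hstable t s _ hJ (EqBelow.runBlock (by simp [Instr.Keeps]) _)
      · simp [runBlock, Instr.run, hr1]
      · simp [runBlock, Instr.run, hr2]
      · simp [runBlock, Instr.run, hr1]
      · rintro s1 ⟨⟨hJ1, hr1, hr2⟩, hf⟩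
        refine HaltsIn.seq (R := fun s' => J (t + 1) s' ∧ s'.natReg r = t ∧
          s'.natReg (r + 1) = t * d) (HaltsIn.ite ?_ ?_) ?_
        · intro hc
          simp only [Test.Holds, hf, (hconst t s1 hJ1).2.2.2] at hc
          exact (hbody t ht s1 hJ1 hr1 hr2 (by omega)).weaken (by omega) fun _ h => h
        · intro hc
          simp only [Test.Holds, hf, (hconst t s1 hJ1).2.2.2] at hc
          refine (HaltsIn.block ?_).weaken (T := 1) (by omega) fun _ h => h
          exact ⟨hskip t ht s1 hJ1 (by omega), hr1, hr2⟩
        · rintro s2 ⟨hJ2, hr1, hr2⟩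
          have hc := hconst _ _ hJ2
          refine HaltsIn.block ⟨?_, ?_, ?_⟩
          · exact hstable _ s2 _ hJ2 (EqBelow.runBlock (by simp [Instr.Keeps]) _)
          · simp [runBlock, Instr.run, hr1, hc.2.1,
              show 3 ≠ r + 1 by omega]
          · simp [runBlock, Instr.run, Function.update_apply, hr2, hc.1, add_mul])
  refine (HaltsIn.seq (R := I 0) (HaltsIn.block ⟨?_, ?_, ?_⟩) fun s' hs' => hfor s' hs').weaken ?_
    fun s' hs' => hs'.1
  · exact hstable 0 s _ hs (EqBelow.runBlock (by simp [Instr.Keeps]) _)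
  · simp [runBlock, Instr.run]
  · simp [runBlock, Instr.run]
  · simp
    ring_nf
    omega

end RealRAM

namespace RealRAM

open OrderedMedian

/-! ### The peeling phase -/

/-- The layout of the state during the peeling: `U` is the set of points with flag `0`, and the
squared radius `m i` is stored behind the coordinates of the points. -/
structure Layout {d n : ℕ} (x : Fin n → EuclideanSpace ℝ (Fin d)) (k : ℕ) (ε : ℝ)
    (U : Finset (Fin n)) (m : Fin n → ℝ) (s : State) : Prop where
  dim : s.natReg 1 = d
  one : s.natReg 3 = 1
  -- Tests are non-strict, so `n - 1` and `d - 1` are stored as loop bounds.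
  last : s.natReg 4 + 1 = n
  lastCoord : s.natReg 5 + 1 = d
  twoK : s.natReg 6 = 2 * k
  base : s.natReg 7 = n * d
  card : s.natReg 8 = U.card
  zero : s.natReg 9 = 0
  scale : s.realReg 1 = ε ^ 2 / 16
  pts : ∀ (i : Fin n) (j : Fin d), s.realMem (i * d + j) = x i j
  rad : ∀ i : Fin n, s.realMem (n * d + i) = m i
  flag : ∀ i : Fin n, s.natMem i = if i ∈ U then 0 else 1

section

variable {d n : ℕ} {x : Fin n → EuclideanSpace ℝ (Fin d)} {k : ℕ} {ε : ℝ} {U : Finset (Fin n)}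
  {m : Fin n → ℝ} {s s' : State}

theorem Layout.congr (h : Layout x k ε U m s) (e : EqBelow 10 2 s s') : Layout x k ε U m s' where
  dim := (e.nat 1 (by norm_num)).trans h.dim
  one := (e.nat 3 (by norm_num)).trans h.one
  last := by rw [e.nat 4 (by norm_num), h.last]
  lastCoord := by rw [e.nat 5 (by norm_num), h.lastCoord]
  twoK := (e.nat 6 (by norm_num)).trans h.twoK
  base := (e.nat 7 (by norm_num)).trans h.base
  card := (e.nat 8 (by norm_num)).trans h.card
  zero := (e.nat 9 (by norm_num)).trans h.zero
  scale := (e.real 1 (by norm_num)).trans h.scale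
  pts := by rw [e.realMem]; exact h.pts
  rad := by rw [e.realMem]; exact h.rad
  flag := by rw [e.natMem]; exact h.flag

theorem Layout.mem_of_flag (h : Layout x k ε U m s) {t : ℕ} (ht : t < n) (hf : s.natMem t = 0) :
    (⟨t, ht⟩ : Fin n) ∈ U := by
  by_contra hc
  have := h.flag ⟨t, ht⟩
  rw [if_neg hc] at this
  simp only [hf] at this
  omega

theorem Layout.notMem_of_flag (h : Layout x k ε U m s) {t : ℕ} (ht : t < n)
    (hf : s.natMem t ≠ 0) : (⟨t, ht⟩ : Fin n) ∉ U := by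
  intro hc
  have := h.flag ⟨t, ht⟩
  rw [if_pos hc] at this
  exact hf this

theorem Layout.distProg_spec (h : Layout x k ε U m s) {a b : Fin n} {pa pb res : ℕ}
    (hpa : pa < 40) (hpb : pb < 40) (hres : res < 40) (ha : s.natReg pa = a * d)
    (hb : s.natReg pb = b * d) :
    HaltsIn (distProg pa pb res) s (10 * d + 6) fun s' =>
      EqBelow 40 res s s' ∧ (∀ a, res < a → a < 40 → s'.realReg a = s.realReg a) ∧
        s'.realReg res = sqDist x a b :=
  RealRAM.distProg_spec (x a) (x b) hpa hpb hres h.one h.lastCoord h.zero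
    (fun j => by rw [ha, h.pts]) (fun j => by rw [hb, h.pts])

theorem filter_lt_succ_of_mem {S : Finset (Fin n)} {t : ℕ} (ht : t < n)
    (hS : (⟨t, ht⟩ : Fin n) ∈ S) :
    S.filter (fun i : Fin n => (i : ℕ) < t + 1) =
      insert ⟨t, ht⟩ (S.filter fun i : Fin n => (i : ℕ) < t) := by
  ext i
  simp only [Finset.mem_filter, Finset.mem_insert, Fin.ext_iff]
  constructor
  · rintro ⟨h1, h2⟩
    rcases Nat.lt_succ_iff_lt_or_eq.1 h2 with h | h
    · exact Or.inr ⟨h1, h⟩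
    · exact Or.inl h
  · rintro (h | ⟨h1, h2⟩)
    · have : i = ⟨t, ht⟩ := Fin.ext h
      subst this
      exact ⟨hS, by simp⟩
    · exact ⟨h1, by omega⟩

theorem filter_lt_succ_of_notMem {S : Finset (Fin n)} {t : ℕ} (ht : t < n)
    (hS : (⟨t, ht⟩ : Fin n) ∉ S) :
    S.filter (fun i : Fin n => (i : ℕ) < t + 1) = S.filter fun i : Fin n => (i : ℕ) < t := by
  refine Finset.filter_congr fun i hi => ?_
  have : (i : ℕ) ≠ t := by
    rintro rfl
    exact hS hi
  omega

theorem filter_lt_self (S : Finset (Fin n)) : S.filter (fun i : Fin n => (i : ℕ) < n) = S :=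
  Finset.filter_true_of_mem fun i _ => i.2

/-- Computes in register `18` the number of points of `U` whose squared distance from the point at
the address in register `13` is at most the real register `3`, times the content of register
`6`. -/
def countProg : Prog :=
  .seq (block [.natConst 18 0])
    -- Counting in steps of `2k` gives the right side of the inequality in `Heavy` without
    -- multiplying natural numbers.
    (forAlive 19 (.seq (distProg 13 20 4) (.ite (.realLe 4 3) (block [.natAdd 18 18 6])
      (block []))))

theorem countProg_spec (h : Layout x k ε U m s) {a b : Fin n} (ha : s.natReg 13 = a * d)
    (hg : s.realReg 3 = sqDist x a b) :
    HaltsIn countProg s (2 + (n * (10 * d + 17) + 4)) fun s' =>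
      EqBelow 18 4 s s' ∧ s'.natReg 18 = 2 * k * (ballIn x U a b).card := by
  let J : ℕ → State → Prop := fun t s' => EqBelow 18 4 s s' ∧
    s'.natReg 18 = 2 * k * ((ballIn x U a b).filter fun i : Fin n => (i : ℕ) < t).card
  have hloop := forAlive_spec (d := d) (n := n) (r := 19) (T := (10 * d + 6) + (2 + 1))
    (by norm_num)
    (body := .seq (distProg 13 20 4) (.ite (.realLe 4 3) (block [.natAdd 18 18 6]) (block []))) J
    (fun t s' hs' => by
      have hL := h.congr (hs'.1.mono (by norm_num) (by norm_num))
      exact ⟨hL.dim, hL.one, hL.last, hL.zero⟩)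
    (fun t s' s'' hs' e => ⟨hs'.1.trans (e.mono (by norm_num) (by norm_num)),
      (e.nat 18 (by norm_num)).trans hs'.2⟩)
    (fun t ht s1 hs1 hr1 hr2 hf => by
      have hL := h.congr (hs1.1.mono (by norm_num) (by norm_num))
      have hU := hL.mem_of_flag ht hf
      refine HaltsIn.seq (hL.distProg_spec (a := a) (b := ⟨t, ht⟩) (by norm_num) (by norm_num)
        (by norm_num) ((hs1.1.nat 13 (by norm_num)).trans ha) hr2) ?_
      rintro s2 ⟨e, -, hd⟩
      have hg2 : s2.realReg 3 = sqDist x a b := by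
        rw [e.real 3 (by norm_num), hs1.1.real 3 (by norm_num), hg]
      have h18 : s2.natReg 18 = _ := (e.nat 18 (by norm_num)).trans hs1.2
      have h6 : s2.natReg 6 = 2 * k := (e.nat 6 (by norm_num)).trans hL.twoK
      have h19 : s2.natReg 19 = t := (e.nat 19 (by norm_num)).trans hr1
      have h20 : s2.natReg 20 = t * d := (e.nat 20 (by norm_num)).trans hr2
      have e' : EqBelow 18 4 s s2 := hs1.1.trans (e.mono (by norm_num) (by norm_num))
      refine HaltsIn.ite ?_ ?_
      · intro hc
        simp only [Test.Holds, hd, hg2] at hc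
        have hmem : (⟨t, ht⟩ : Fin n) ∈ ballIn x U a b := Finset.mem_filter.2 ⟨hU, hc⟩
        refine HaltsIn.block ⟨⟨e'.trans (EqBelow.runBlock (by simp [Instr.Keeps]) _), ?_⟩, ?_, ?_⟩
        · rw [filter_lt_succ_of_mem ht hmem, Finset.card_insert_of_notMem (by simp)]
          simp [runBlock, Instr.run, h18, h6]
          ring
        · simp [runBlock, Instr.run, h19]
        · simp [runBlock, Instr.run, h20]
      · intro hc
        simp only [Test.Holds, hd, hg2] at hc
        have hmem : (⟨t, ht⟩ : Fin n) ∉ ballIn x U a b := fun hm => hc (Finset.mem_filter.1 hm).2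
        refine (HaltsIn.block (l := []) ⟨⟨e', ?_⟩, h19, h20⟩).weaken (by simp) fun _ h => h
        rw [filter_lt_succ_of_notMem ht hmem]
        exact h18)
    (fun t ht s1 hs1 hf => by
      have hL := h.congr (hs1.1.mono (by norm_num) (by norm_num))
      have hU := hL.notMem_of_flag ht hf
      refine ⟨hs1.1, ?_⟩
      rw [filter_lt_succ_of_notMem (S := ballIn x U a b) ht
        fun hm => hU (Finset.mem_filter.1 hm).1]
      exact hs1.2)
  refine (HaltsIn.seq (R := J 0) (HaltsIn.block ⟨?_, ?_⟩) fun s' hs' => hloop s' hs').weaken ?_ ?_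
  · exact EqBelow.runBlock (by simp [Instr.Keeps]) _
  · simp [runBlock, Instr.run]
  · simp
  · rintro s' ⟨he, h18⟩
    rw [filter_lt_self] at h18
    exact ⟨he, h18⟩

/-- Among the pairs with property `V`, the registers hold a smallest heavy one, if there is one. -/
def Best (x : Fin n → EuclideanSpace ℝ (Fin d)) (k : ℕ) (U : Finset (Fin n))
    (V : Fin n → Fin n → Prop) (s : State) : Prop :=
  (s.natReg 10 = 0 ∧ ∀ a b, V a b → ¬ Heavy x k U a b) ∨
    (s.natReg 10 = 1 ∧ ∃ a b : Fin n, Heavy x k U a b ∧ s.natReg 11 = a * d ∧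
      s.realReg 2 = sqDist x a b ∧
      ∀ a' b', V a' b' → Heavy x k U a' b' → sqDist x a b ≤ sqDist x a' b')

theorem Best.congr {V : Fin n → Fin n → Prop} (h : Best x k U V s)
    (h10 : s'.natReg 10 = s.natReg 10) (h11 : s'.natReg 11 = s.natReg 11)
    (h2 : s'.realReg 2 = s.realReg 2) : Best x k U V s' := by
  unfold Best
  rw [h10, h11, h2]
  exact h

theorem Best.extend {V V' : Fin n → Fin n → Prop} (h : Best x k U V s)
    (hV : ∀ a b, V' a b → Heavy x k U a b → V a b) : Best x k U V' s := by
  rcases h with ⟨h10, h⟩ | ⟨h10, a, b, hab, h11, h2, h⟩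
  · exact Or.inl ⟨h10, fun a b hv hh => h a b (hV a b hv hh) hh⟩
  · exact Or.inr ⟨h10, a, b, hab, h11, h2, fun a' b' hv hh => h a' b' (hV a' b' hv hh) hh⟩

/-- Records the current pair as the best one. -/
def recordProg : Prog := block [.natConst 10 1, .natAdd 11 13 9, .realConst 2 0, .realAdd 2 2 3]

/-- Examines the current pair. -/
def examineProg : Prog :=
  .seq (distProg 13 16 3) (.seq countProg (.ite (.natLe 8 18)
    (.ite (.natLe 10 9) recordProg (.ite (.realLe 2 3) (block []) recordProg)) (block [])))

/-- Extends the range of the minimum by the single pair `(a, b)`. Registers `12` to `17` hold the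
counters of the two enclosing loops and must survive. -/
theorem examineProg_spec (h : Layout x k ε U m s) {a b : Fin n} (haU : a ∈ U) (hbU : b ∈ U)
    (ha : s.natReg 13 = a * d) (hb : s.natReg 16 = b * d) {V V' : Fin n → Fin n → Prop}
    (hV : ∀ a' b', V' a' b' → V a' b' ∨ (a' = a ∧ b' = b)) (hs : Best x k U V s) :
    HaltsIn examineProg s (10 * d + 6 + (2 + (n * (10 * d + 17) + 4) + 8)) fun s' =>
      EqBelow 10 2 s s' ∧ (∀ r, 12 ≤ r → r < 18 → s'.natReg r = s.natReg r) ∧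
        Best x k U V' s' := by
  refine HaltsIn.seq (h.distProg_spec (by norm_num) (by norm_num) (by norm_num) ha hb) ?_
  rintro s1 ⟨e1, -, hg⟩
  have hL1 := h.congr (e1.mono (by norm_num) (by norm_num))
  refine HaltsIn.seq (countProg_spec hL1 ((e1.nat 13 (by norm_num)).trans ha) hg) ?_
  rintro s2 ⟨e2, h18⟩
  have hL2 := hL1.congr (e2.mono (by norm_num) (by norm_num))
  have e : EqBelow 18 3 s s2 :=
    (e1.mono (by norm_num) (by norm_num)).trans (e2.mono (by norm_num) (by norm_num))
  have hB : Best x k U V s2 := hs.congr (e.nat 10 (by norm_num)) (e.nat 11 (by norm_num))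
    (e.real 2 (by norm_num))
  have hg2 : s2.realReg 3 = sqDist x a b := (e2.real 3 (by norm_num)).trans hg
  have h13 : s2.natReg 13 = a * d := (e.nat 13 (by norm_num)).trans ha
  have hskip : ∀ {T : ℕ}, Best x k U V' s2 → HaltsIn (block []) s2 (T + 1) fun s' =>
      EqBelow 10 2 s s' ∧ (∀ r, 12 ≤ r → r < 18 → s'.natReg r = s.natReg r) ∧
        Best x k U V' s' := fun hB' =>
    (HaltsIn.block (l := []) ⟨e.mono (by norm_num) (by norm_num), fun r _ hr => e.nat r hr,
      hB'⟩).weaken (by simp) fun _ h => h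
  have hrecord : Heavy x k U a b → (∀ a' b', V a' b' → Heavy x k U a' b' →
      sqDist x a b ≤ sqDist x a' b') → HaltsIn recordProg s2 5 fun s' =>
      EqBelow 10 2 s s' ∧ (∀ r, 12 ≤ r → r < 18 → s'.natReg r = s.natReg r) ∧
        Best x k U V' s' := by
    intro hab hmin
    refine HaltsIn.block ⟨(e.mono (by norm_num) (by norm_num)).trans
      (EqBelow.runBlock (by simp [Instr.Keeps]) _), fun r hr hr' => ?_,
      Or.inr ⟨?_, a, b, hab, ?_, ?_, ?_⟩⟩
    · rw [← e.nat r hr']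
      simp [runBlock, Instr.run, show r ≠ 11 by omega,
        show r ≠ 10 by omega]
    · simp [runBlock, Instr.run]
    · simp [runBlock, Instr.run, h13, hL2.zero]
    · simp [runBlock, Instr.run, hg2]
    · intro a' b' hv hh
      rcases hV a' b' hv with hv | ⟨rfl, rfl⟩
      · exact hmin a' b' hv hh
      · exact le_rfl
  refine HaltsIn.ite (T := 7) (fun hc => ?_) (fun hc => ?_)
  · simp only [Test.Holds, hL2.card, h18] at hc
    have hab : Heavy x k U a b := ⟨haU, hbU, hc⟩
    refine HaltsIn.ite (T := 6) (fun hc => ?_) (fun hc => ?_)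
    · simp only [Test.Holds, hL2.zero, nonpos_iff_eq_zero] at hc
      refine (hrecord hab fun a' b' hv hh => ?_).weaken (by norm_num) fun _ h => h
      rcases hB with ⟨-, hno⟩ | ⟨h10, -⟩
      · exact absurd hh (hno a' b' hv)
      · omega
    · simp only [Test.Holds, hL2.zero, nonpos_iff_eq_zero] at hc
      obtain ⟨h10, a0, b0, hab0, h11, h2, hmin⟩ := hB.resolve_left fun h => hc h.1
      refine HaltsIn.ite (T := 5) (fun hle => ?_) (fun hle => ?_)
      · simp only [Test.Holds, h2, hg2] at hle
        refine hskip (Or.inr ⟨h10, a0, b0, hab0, h11, h2, fun a' b' hv hh => ?_⟩)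
        rcases hV a' b' hv with hv | ⟨rfl, rfl⟩
        · exact hmin a' b' hv hh
        · exact hle
      · simp only [Test.Holds, h2, hg2, not_le] at hle
        exact hrecord hab fun a' b' hv hh => hle.le.trans (hmin a' b' hv hh)
  · simp only [Test.Holds, hL2.card, h18] at hc
    refine hskip (hB.extend fun a' b' hv hh => ?_)
    rcases hV a' b' hv with hv | ⟨rfl, rfl⟩
    · exact hv
    · exact absurd hh.2.2 hc

/-- Finds a smallest heavy ball. -/
def searchProg : Prog :=
  .seq (block [.natConst 10 0]) (forAlive 12 (forAlive 15 examineProg))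

theorem searchProg_spec (h : Layout x k ε U m s) :
    HaltsIn searchProg s (2 + (n * ((n * ((10 * d + 6 + (2 + (n * (10 * d + 17) + 4) + 8)) + 8) + 4)
      + 8) + 4)) fun s' => EqBelow 10 2 s s' ∧ Best x k U (fun _ _ => True) s' := by
  let J : ℕ → State → Prop := fun t s' => EqBelow 10 2 s s' ∧
    Best x k U (fun a _ => (a : ℕ) < t) s'
  have hloop := forAlive_spec (d := d) (n := n) (r := 12)
    (T := n * ((10 * d + 6 + (2 + (n * (10 * d + 17) + 4) + 8)) + 8) + 4)
    (by norm_num) (body := forAlive 15 examineProg) J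
    (fun t s' hs' => by
      have hL := h.congr hs'.1
      exact ⟨hL.dim, hL.one, hL.last, hL.zero⟩)
    (fun t s' s'' hs' e => ⟨hs'.1.trans (e.mono (by norm_num) (by norm_num)),
      hs'.2.congr (e.nat _ (by norm_num)) (e.nat _ (by norm_num)) (e.real _ (by norm_num))⟩)
    (fun t ht s1 hs1 hr1 hr2 hf => by
      have hU := (h.congr hs1.1).mem_of_flag ht hf
      -- Pairs are examined in lexicographic order; skipped points are outside `U` and belong to no
      -- heavy pair.
      let J' : ℕ → State → Prop := fun t' s' => EqBelow 10 2 s s' ∧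
        Best x k U (fun a b => (a : ℕ) < t ∨ (a = ⟨t, ht⟩ ∧ (b : ℕ) < t')) s' ∧
        s'.natReg 12 = t ∧ s'.natReg 13 = t * d
      have hinner := forAlive_spec (d := d) (n := n) (r := 15)
        (T := 10 * d + 6 + (2 + (n * (10 * d + 17) + 4) + 8))
        (by norm_num) (body := examineProg) J'
        (fun t s' hs' => by
          have hL := h.congr hs'.1
          exact ⟨hL.dim, hL.one, hL.last, hL.zero⟩)
        (fun t s' s'' hs' e => ⟨hs'.1.trans (e.mono (by norm_num) (by norm_num)),
          hs'.2.1.congr (e.nat _ (by norm_num)) (e.nat _ (by norm_num)) (e.real _ (by norm_num)),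
          (e.nat _ (by norm_num)).trans hs'.2.2.1, (e.nat _ (by norm_num)).trans hs'.2.2.2⟩)
        (fun t' ht' s2 hs2 hr1' hr2' hf' => by
          have hL2 := h.congr hs2.1
          have hU' := hL2.mem_of_flag ht' hf'
          refine (examineProg_spec hL2 (a := ⟨t, ht⟩) (b := ⟨t', ht'⟩)
            (V' := fun a b => (a : ℕ) < t ∨ (a = ⟨t, ht⟩ ∧ (b : ℕ) < t' + 1))
            hU hU' hs2.2.2.2 hr2' ?_ hs2.2.1).weaken le_rfl ?_
          · rintro a b (hab | ⟨rfl, hb⟩)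
            · exact Or.inl (Or.inl hab)
            · rcases Nat.lt_succ_iff_lt_or_eq.1 hb with hb | hb
              · exact Or.inl (Or.inr ⟨rfl, hb⟩)
              · exact Or.inr ⟨rfl, Fin.ext hb⟩
          · rintro s3 ⟨e, hr, hB⟩
            refine ⟨⟨hs2.1.trans e, hB, ?_, ?_⟩, ?_, ?_⟩
            · rw [hr 12 (by norm_num) (by norm_num), hs2.2.2.1]
            · rw [hr 13 (by norm_num) (by norm_num), hs2.2.2.2]
            · rw [hr 15 (by norm_num) (by norm_num), hr1']
            · rw [hr 16 (by norm_num) (by norm_num), hr2'])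
        (fun t' ht' s2 hs2 hf' => by
          have hU' := (h.congr hs2.1).notMem_of_flag ht' hf'
          refine ⟨hs2.1, hs2.2.1.extend ?_, hs2.2.2⟩
          rintro a b (hab | ⟨rfl, hb⟩) hh
          · exact Or.inl hab
          · rcases Nat.lt_succ_iff_lt_or_eq.1 hb with hb | hb
            · exact Or.inr ⟨rfl, hb⟩
            · have : b = ⟨t', ht'⟩ := Fin.ext hb
              subst this
              exact absurd hh.2.1 hU')
        s1 ⟨hs1.1, hs1.2.extend (by
          rintro a b (hab | ⟨-, hb⟩) -
          · exact hab
          · omega), hr1, hr2⟩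
      refine hinner.weaken le_rfl ?_
      rintro s2 ⟨e, hB, h12, h13⟩
      refine ⟨⟨e, hB.extend ?_⟩, h12, h13⟩
      rintro a b hab -
      rcases Nat.lt_succ_iff_lt_or_eq.1 hab with ha | ha
      · exact Or.inl ha
      · exact Or.inr ⟨Fin.ext ha, b.2⟩)
    (fun t ht s1 hs1 hf => by
      have hU := (h.congr hs1.1).notMem_of_flag ht hf
      refine ⟨hs1.1, hs1.2.extend ?_⟩
      intro a b hab hh
      rcases Nat.lt_succ_iff_lt_or_eq.1 hab with ha | ha
      · exact ha
      · have : a = ⟨t, ht⟩ := Fin.ext ha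
        subst this
        exact absurd hh.1 hU)
  refine (HaltsIn.seq (R := J 0) (HaltsIn.block ⟨?_, Or.inl ⟨?_, ?_⟩⟩)
    fun s' hs' => hloop s' hs').weaken (by simp) ?_
  · exact EqBelow.runBlock (by simp [Instr.Keeps]) _
  · simp [runBlock, Instr.run]
  · simp
  · rintro s' ⟨e, hB⟩
    exact ⟨e, hB.extend fun a _ _ _ => a.2⟩

/-- Removes the ball that has been found. -/
def removeProg : Prog :=
  forAlive 12 (.seq (distProg 11 13 3) (.ite (.realLe 3 2)
    (block [.natStore 12 3, .natAdd 14 7 12, .realStore 14 2, .natSub 8 8 3]) (block [])))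

theorem removeProg_spec (h : Layout x k ε U m s) {a b : Fin n} (ha : s.natReg 11 = a * d)
    (hg : s.realReg 2 = sqDist x a b) :
    HaltsIn removeProg s (n * (10 * d + 20) + 4)
      (Layout x k ε (U \ ballIn x U a b)
        fun i => if i ∈ ballIn x U a b then sqDist x a b else m i) := by
  set R := ballIn x U a b with hR
  have hRU : R ⊆ U := Finset.filter_subset _ _
  -- The ball is fixed with respect to the original `U`; only its points of index below `t` have
  -- been removed so far, so the flag of point `t` is still the original one.
  let J : ℕ → State → Prop := fun t s' =>
    Layout x k ε (U \ R.filter fun i : Fin n => (i : ℕ) < t)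
      (fun i => if i ∈ R.filter (fun i : Fin n => (i : ℕ) < t) then sqDist x a b else m i) s' ∧
    s'.natReg 11 = a * d ∧ s'.realReg 2 = sqDist x a b
  have hself : ∀ {t : ℕ} (ht : t < n), (⟨t, ht⟩ : Fin n) ∉
      R.filter fun i : Fin n => (i : ℕ) < t := by
    simp
  have hloop := forAlive_spec (d := d) (n := n) (r := 12) (T := (10 * d + 6) + (5 + 1))
    (by norm_num)
    (body := .seq (distProg 11 13 3) (.ite (.realLe 3 2)
      (block [.natStore 12 3, .natAdd 14 7 12, .realStore 14 2, .natSub 8 8 3]) (block []))) J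
    (fun t s' hs' => ⟨hs'.1.dim, hs'.1.one, hs'.1.last, hs'.1.zero⟩)
    (fun t s' s'' hs' e => ⟨hs'.1.congr (e.mono (by norm_num) (by norm_num)),
      (e.nat _ (by norm_num)).trans hs'.2.1, (e.real _ (by norm_num)).trans hs'.2.2⟩)
    (fun t ht s1 hs1 hr1 hr2 hf => by
      obtain ⟨hL, h11, h2⟩ := hs1
      have hU' := hL.mem_of_flag ht hf
      have hU := (Finset.mem_sdiff.1 hU').1
      refine HaltsIn.seq (hL.distProg_spec (a := a) (b := ⟨t, ht⟩) (by norm_num) (by norm_num)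
        (by norm_num) h11 hr2) ?_
      rintro s2 ⟨e, -, hd⟩
      have hL2 := hL.congr (e.mono (by norm_num) (by norm_num))
      have h11 := (e.nat 11 (by norm_num)).trans h11
      have h12 := (e.nat 12 (by norm_num)).trans hr1
      have h13 := (e.nat 13 (by norm_num)).trans hr2
      have h2 := (e.real 2 (by norm_num)).trans h2
      refine HaltsIn.ite ?_ ?_
      · intro hc
        simp only [Test.Holds, hd, h2] at hc
        have hmem : (⟨t, ht⟩ : Fin n) ∈ R := Finset.mem_filter.2 ⟨hU, hc⟩
        have hset : U \ R.filter (fun i : Fin n => (i : ℕ) < t + 1) =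
            (U \ R.filter fun i : Fin n => (i : ℕ) < t).erase ⟨t, ht⟩ := by
          rw [filter_lt_succ_of_mem ht hmem]
          ext i
          simp only [Finset.mem_sdiff, Finset.mem_insert, Finset.mem_erase]
          tauto
        refine HaltsIn.block ⟨⟨⟨?_, ?_, ?_, ?_, ?_, ?_, ?_, ?_, ?_, ?_, ?_, ?_⟩, ?_, ?_⟩, ?_, ?_⟩
        · simp [runBlock, Instr.run, hL2.dim]
        · simp [runBlock, Instr.run, hL2.one]
        · simp [runBlock, Instr.run, hL2.last]
        · simp [runBlock, Instr.run, hL2.lastCoord]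
        · simp [runBlock, Instr.run, hL2.twoK]
        · simp [runBlock, Instr.run, hL2.base]
        · rw [hset, Finset.card_erase_of_mem hU', ← hL2.card]
          simp [runBlock, Instr.run, hL2.one]
        · simp [runBlock, Instr.run, hL2.zero]
        · simp [runBlock, Instr.run, hL2.scale]
        · intro i j
          have hlt : (i : ℕ) * d + j < n * d := by
            have := Nat.mul_le_mul_right d i.2
            rw [Nat.succ_mul] at this
            omega
          have := hL2.pts i j
          simp [runBlock, Instr.run, hL2.base, h12, Function.update_apply]
          rw [if_neg (by omega), this]
        · intro i
          have := hL2.rad i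
          rw [filter_lt_succ_of_mem ht hmem]
          by_cases hi : i = ⟨t, ht⟩
          · subst hi
            simp [runBlock, Instr.run, hL2.base, h12, h2]
          · have hne : (i : ℕ) ≠ t := fun h => hi (Fin.ext h)
            simp only [Finset.mem_insert, hi, false_or]
            rw [← this]
            simp [runBlock, Instr.run, hL2.base, h12, hne]
        · intro i
          have := hL2.flag i
          rw [hset]
          by_cases hi : i = ⟨t, ht⟩
          · subst hi
            simp [runBlock, Instr.run, h12, hL2.one]
          · have hne : (i : ℕ) ≠ t := fun h => hi (Fin.ext h)
            simp only [Finset.mem_erase, ne_eq, hi, not_false_eq_true, true_and]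
            rw [← this]
            simp [runBlock, Instr.run, h12, hne]
        · simp [runBlock, Instr.run, h11]
        · simp [runBlock, Instr.run, h2]
        · simp [runBlock, Instr.run, h12]
        · simp [runBlock, Instr.run, h13]
      · intro hc
        simp only [Test.Holds, hd, h2] at hc
        have hmem : (⟨t, ht⟩ : Fin n) ∉ R := fun hm => hc (Finset.mem_filter.1 hm).2
        refine (HaltsIn.block (l := []) ⟨⟨?_, h11, h2⟩, h12, h13⟩).weaken (by simp) fun _ h => h
        rw [filter_lt_succ_of_notMem ht hmem]
        exact hL2)
    (fun t ht s1 hs1 hf => by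
      have hU := hs1.1.notMem_of_flag ht hf
      have hmem : (⟨t, ht⟩ : Fin n) ∉ R := fun hm =>
        hU (Finset.mem_sdiff.2 ⟨hRU hm, hself ht⟩)
      refine ⟨?_, hs1.2⟩
      rw [filter_lt_succ_of_notMem ht hmem]
      exact hs1.1)
    s ⟨by simpa using h, ha, hg⟩
  refine hloop.weaken (le_of_eq (by ring)) ?_
  rintro s' ⟨hL, -⟩
  rw [filter_lt_self] at hL
  exact hL

/-- Removes smallest heavy balls until no point is left. -/
def peelProg : Prog := .while (.natLe 3 8) (.seq searchProg removeProg)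

/-- A bound for the number of steps of one round of peeling. -/
def roundTime {S : Type*} [Semiring S] (n d : S) : S :=
  2 + (n * ((n * ((10 * d + 6 + (2 + (n * (10 * d + 17) + 4) + 8)) + 8) + 4) + 8) + 4) +
    (n * (10 * d + 20) + 4)

theorem peelProg_spec (hk : 1 ≤ k) (h : Layout x k ε U m s) (hP : Peeled x k U m) :
    HaltsIn peelProg s (U.card * (roundTime n d + 1) + 1) fun s' =>
      ∃ m', Layout x k ε ∅ m' s' ∧ Peeled x k ∅ m' := by
  classical
  -- Termination by `|U|`: each ball contains its center, so each round removes a point. The crude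
  -- bound of `n` rounds is enough for polynomial time.
  refine (HaltsIn.while (I := fun c s => ∃ U m, Layout x k ε U m s ∧ Peeled x k U m ∧ U.card = c)
    ?_ ?_ U.card ⟨U, m, h, hP, rfl⟩).weaken le_rfl ?_
  · rintro c s ⟨U, m, hL, -, rfl⟩
    simp only [Test.Holds, hL.one, hL.card]
    exact Nat.succ_le_iff
  · rintro c hc s ⟨U, m, hL, hP, rfl⟩
    refine (HaltsIn.seq (searchProg_spec hL) ?_).weaken
      (T := _ + (n * (10 * d + 20) + 4)) (le_of_eq rfl) fun _ h => h
    rintro s1 ⟨e, hB⟩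
    have hL1 := hL.congr e
    obtain ⟨-, a, b, hab, h11, h2, hmin⟩ : _ := hB.resolve_left (by
      rintro ⟨-, hno⟩
      obtain ⟨a, b, hab⟩ := exists_heavy x hk (Finset.card_pos.1 hc)
      exact hno a b trivial hab)
    refine (removeProg_spec hL1 h11 h2).weaken le_rfl fun s2 hL2 => ?_
    have haR : a ∈ ballIn x U a b := by
      refine Finset.mem_filter.2 ⟨hab.1, ?_⟩
      simp [sqDist]
    refine ⟨_, ?_, _, _, hL2, hP.step hk hab (fun a' b' => hmin a' b' trivial) ?_ ?_, rfl⟩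
    · exact Finset.card_lt_card (Finset.ssubset_iff_of_subset Finset.sdiff_subset |>.2
        ⟨a, hab.1, fun hm => (Finset.mem_sdiff.1 hm).2 haR⟩)
    · intro i hi
      exact if_neg fun hm => hi (Finset.mem_filter.1 hm).1
    · intro i hi
      exact if_pos hi
  · rintro s' ⟨U', m', hL, hP, hc⟩
    rw [Finset.card_eq_zero] at hc
    subst hc
    exact ⟨m', hL, hP⟩

end

end RealRAM

namespace OrderedMedian

/-! ### Greedy nets relative to the peeling radii. -/

section

variable {d n : ℕ} {x : Fin n → EuclideanSpace ℝ (Fin d)} {m : Fin n → ℝ} {c : ℝ} {t R : ℕ}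
  {rep : ℕ → Fin n} {asg : Fin n → ℕ}

/-- A greedy net of the first `t` points: `rep 0, …, rep (R - 1)` are the representatives, the
point `i` is assigned to `rep (asg i)`, and `c * m i` is the squared radius at `i`. -/
structure Net (x : Fin n → EuclideanSpace ℝ (Fin d)) (m : Fin n → ℝ) (c : ℝ) (t R : ℕ)
    (rep : ℕ → Fin n) (asg : Fin n → ℕ) : Prop where
  le : R ≤ t
  rep_lt : ∀ r < R, (rep r : ℕ) < t
  rep_mono : ∀ r r', r < r' → r' < R → rep r < rep r'
  asg_lt : ∀ i : Fin n, (i : ℕ) < t → asg i < R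
  near : ∀ i : Fin n, (i : ℕ) < t → sqDist x i (rep (asg i)) ≤ c * m i
  asg_rep : ∀ r < R, asg (rep r) = r
  sep : ∀ r r', r < r' → r' < R → c * m (rep r') < sqDist x (rep r) (rep r')

theorem sqDist_comm (x : Fin n → EuclideanSpace ℝ (Fin d)) (i j : Fin n) :
    sqDist x i j = sqDist x j i := by
  simp [sqDist, dist_comm]

theorem Net.join (h : Net x m c t R rep asg) (ht : t < n) {r : ℕ} (hr : r < R)
    (hd : sqDist x ⟨t, ht⟩ (rep r) ≤ c * m ⟨t, ht⟩) :
    Net x m c (t + 1) R rep (Function.update asg ⟨t, ht⟩ r) := by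
  have hcase : ∀ i : Fin n, (i : ℕ) < t + 1 → i = ⟨t, ht⟩ ∨ (i ≠ ⟨t, ht⟩ ∧ (i : ℕ) < t) := by
    intro i hi
    simp only [ne_eq, Fin.ext_iff]
    omega
  refine ⟨h.le.trans (Nat.le_succ _), fun r hr => (h.rep_lt r hr).trans (Nat.lt_succ_self _),
    h.rep_mono, ?_, ?_, ?_, h.sep⟩
  · intro i hi
    rcases hcase i hi with rfl | ⟨hne, hi⟩
    · simpa using hr
    · simpa [hne] using h.asg_lt i hi
  · intro i hi
    rcases hcase i hi with rfl | ⟨hne, hi⟩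
    · simpa using hd
    · simpa [hne] using h.near i hi
  · intro r' hr'
    have hne : rep r' ≠ ⟨t, ht⟩ := by
      intro he
      have := h.rep_lt r' hr'
      rw [he] at this
      exact lt_irrefl _ this
    simpa [hne] using h.asg_rep r' hr'

theorem Net.insert (h : Net x m c t R rep asg) (ht : t < n) (hm : 0 ≤ c * m ⟨t, ht⟩)
    (hd : ∀ r < R, c * m ⟨t, ht⟩ < sqDist x ⟨t, ht⟩ (rep r)) :
    Net x m c (t + 1) (R + 1) (Function.update rep R ⟨t, ht⟩)
      (Function.update asg ⟨t, ht⟩ R) := by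
  have hcase : ∀ i : Fin n, (i : ℕ) < t + 1 → i = ⟨t, ht⟩ ∨ (i ≠ ⟨t, ht⟩ ∧ (i : ℕ) < t) := by
    intro i hi
    simp only [ne_eq, Fin.ext_iff]
    omega
  have hrep : ∀ r < R, Function.update rep R ⟨t, ht⟩ r = rep r := fun r hr =>
    Function.update_of_ne hr.ne _ _
  have hcaseR : ∀ r, r < R + 1 → r = R ∨ r < R := fun r hr => by omega
  refine ⟨Nat.succ_le_succ h.le, ?_, ?_, ?_, ?_, ?_, ?_⟩
  · intro r hr
    rcases hcaseR r hr with rfl | hr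
    · simp
    · rw [hrep r hr]
      exact (h.rep_lt r hr).trans (Nat.lt_succ_self _)
  · intro r r' hrr hr'
    rcases hcaseR r' hr' with rfl | hr'
    · rw [hrep r hrr, Function.update_self]
      exact h.rep_lt r hrr
    · rw [hrep r (hrr.trans hr'), hrep r' hr']
      exact h.rep_mono r r' hrr hr'
  · intro i hi
    rcases hcase i hi with rfl | ⟨hne, hi⟩
    · simp
    · simpa [hne] using (h.asg_lt i hi).trans (Nat.lt_succ_self _)
  · intro i hi
    rcases hcase i hi with rfl | ⟨hne, hi⟩
    · simpa [sqDist] using hm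
    · rw [Function.update_of_ne hne, hrep _ (h.asg_lt i hi)]
      exact h.near i hi
  · intro r hr
    rcases hcaseR r hr with rfl | hr
    · simp
    · have hne : rep r ≠ ⟨t, ht⟩ := by
        intro he
        have := h.rep_lt r hr
        rw [he] at this
        exact lt_irrefl _ this
      rw [hrep r hr, Function.update_of_ne hne, h.asg_rep r hr]
  · intro r r' hrr hr'
    rcases hcaseR r' hr' with rfl | hr'
    · rw [hrep r hrr, Function.update_self, sqDist_comm]
      exact hd r hrr
    · rw [hrep r (hrr.trans hr'), hrep r' hr']
      exact h.sep r r' hrr hr'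

/-- The number of the first `t` points that are assigned to `r`. -/
def load (asg : Fin n → ℕ) (t r : ℕ) : ℕ :=
  (Finset.univ.filter fun i : Fin n => (i : ℕ) < t ∧ asg i = r).card

theorem load_succ_self (asg : Fin n → ℕ) (ht : t < n) (r : ℕ) :
    load (Function.update asg ⟨t, ht⟩ r) (t + 1) r = load asg t r + 1 := by
  unfold load
  rw [← Finset.card_insert_of_notMem (a := ⟨t, ht⟩) (by simp)]
  congr 1
  ext i
  simp only [Finset.mem_filter, Finset.mem_univ, true_and, Finset.mem_insert]
  by_cases hi : i = ⟨t, ht⟩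
  · subst hi
    simp
  · have : (i : ℕ) ≠ t := fun h => hi (Fin.ext h)
    simp only [hi, Function.update_of_ne hi, false_or, and_congr_left_iff]
    omega

theorem load_succ_of_ne (asg : Fin n → ℕ) (ht : t < n) {r r' : ℕ} (hr : r' ≠ r) :
    load (Function.update asg ⟨t, ht⟩ r) (t + 1) r' = load asg t r' := by
  unfold load
  congr 1
  ext i
  simp only [Finset.mem_filter, Finset.mem_univ, true_and]
  by_cases hi : i = ⟨t, ht⟩
  · subst hi
    simp [hr.symm]
  · have : (i : ℕ) ≠ t := fun h => hi (Fin.ext h)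
    simp only [Function.update_of_ne hi, and_congr_left_iff]
    omega

/-- The next unused number has no points yet, so a new representative starts with multiplicity `1`,
its own. -/
theorem Net.load_eq_zero (h : Net x m c t R rep asg) : load asg t R = 0 := by
  unfold load
  rw [Finset.card_eq_zero, Finset.filter_eq_empty_iff]
  rintro i - ⟨hi, hr⟩
  have := h.asg_lt i hi
  omega

end

end OrderedMedian

namespace RealRAM

open OrderedMedian

section

variable {d n : ℕ} {x : Fin n → EuclideanSpace ℝ (Fin d)} {k : ℕ} {ε : ℝ} {m : Fin n → ℝ}
  {s s' : State} {t R : ℕ} {rep : ℕ → Fin n} {asg : Fin n → ℕ}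

/-! ### Building the net in place on the machine. -/

/-- The contents of registers and memory while the net is built: the representatives replace an
initial segment of the points that have been processed. -/
structure NetLayout (x : Fin n → EuclideanSpace ℝ (Fin d)) (ε : ℝ) (m : Fin n → ℝ) (t R : ℕ)
    (rep : ℕ → Fin n) (asg : Fin n → ℕ) (s : State) : Prop where
  dim : s.natReg 1 = d
  one : s.natReg 3 = 1
  last : s.natReg 4 + 1 = n
  lastCoord : s.natReg 5 + 1 = d
  base : s.natReg 7 = n * d
  zero : s.natReg 9 = 0
  reps : s.natReg 10 = R
  dest : s.natReg 11 = R * d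
  idx : s.natReg 12 = t
  addr : s.natReg 13 = t * d
  scale : s.realReg 1 = ε ^ 2 / 16
  rep_pts : ∀ r < R, ∀ j : Fin d, s.realMem (r * d + j) = x (rep r) j
  pts : ∀ i : Fin n, t ≤ i → ∀ j : Fin d, s.realMem (i * d + j) = x i j
  rad : ∀ i : Fin n, s.realMem (n * d + i) = m i
  mult : ∀ r < R, s.natMem r = load asg t r
  -- The flags left by the peeling serve as initial multiplicities of future representatives.
  flag : ∀ r, R ≤ r → r < n → s.natMem r = 1

theorem NetLayout.congr (h : NetLayout x ε m t R rep asg s) (e : EqBelow 14 2 s s') :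
    NetLayout x ε m t R rep asg s' where
  dim := (e.nat 1 (by norm_num)).trans h.dim
  one := (e.nat 3 (by norm_num)).trans h.one
  last := by rw [e.nat 4 (by norm_num), h.last]
  lastCoord := by rw [e.nat 5 (by norm_num), h.lastCoord]
  base := (e.nat 7 (by norm_num)).trans h.base
  zero := (e.nat 9 (by norm_num)).trans h.zero
  reps := (e.nat 10 (by norm_num)).trans h.reps
  dest := (e.nat 11 (by norm_num)).trans h.dest
  idx := (e.nat 12 (by norm_num)).trans h.idx
  addr := (e.nat 13 (by norm_num)).trans h.addr
  scale := (e.real 1 (by norm_num)).trans h.scale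
  rep_pts := by rw [e.realMem]; exact h.rep_pts
  pts := by rw [e.realMem]; exact h.pts
  rad := by rw [e.realMem]; exact h.rad
  mult := by rw [e.natMem]; exact h.mult
  flag := by rw [e.natMem]; exact h.flag

/-- Puts `r + 1` into register `15` for some representative `r` close to the current point, or `0`
if there is none. -/
def lookupProg : Prog :=
  .seq (block [.natAdd 14 7 12, .realLoad 5 14, .realMul 5 5 1, .natConst 15 0, .natConst 16 1,
      .natConst 17 0])
    (.while (.natLe 16 10) (.seq (distProg 13 17 4)
      (.seq (.ite (.realLe 4 5) (block [.natAdd 15 16 9]) (block []))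
        (block [.natAdd 16 16 3, .natAdd 17 17 1]))))

theorem lookupProg_spec (h : NetLayout x ε m t R rep asg s) (hR : R ≤ n) (ht : t < n) :
    HaltsIn lookupProg s (7 + (n * (10 * d + 13) + 1)) fun s' => EqBelow 14 4 s s' ∧
      ((s'.natReg 15 = 0 ∧ ∀ r < R, ε ^ 2 / 16 * m ⟨t, ht⟩ < sqDist x ⟨t, ht⟩ (rep r)) ∨
        ∃ r < R, s'.natReg 15 = r + 1 ∧ sqDist x ⟨t, ht⟩ (rep r) ≤ ε ^ 2 / 16 * m ⟨t, ht⟩) := by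
  let I : ℕ → State → Prop := fun i s' => EqBelow 14 4 s s' ∧ s'.natReg 16 = i + 1 ∧
    s'.natReg 17 = i * d ∧ s'.realReg 5 = ε ^ 2 / 16 * m ⟨t, ht⟩ ∧
      ((s'.natReg 15 = 0 ∧ ∀ r < i, ε ^ 2 / 16 * m ⟨t, ht⟩ < sqDist x ⟨t, ht⟩ (rep r)) ∨
        ∃ r < R, s'.natReg 15 = r + 1 ∧ sqDist x ⟨t, ht⟩ (rep r) ≤ ε ^ 2 / 16 * m ⟨t, ht⟩)
  have hloop := HaltsIn.for (c := .natLe 16 10) (I := I) (N := R)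
    (T := (10 * d + 6) + ((2 + 1) + 3))
    (p := .seq (distProg 13 17 4)
      (.seq (.ite (.realLe 4 5) (block [.natAdd 15 16 9]) (block []))
        (block [.natAdd 16 16 3, .natAdd 17 17 1])))
    (by
      rintro i - s1 ⟨e, h16, -⟩
      simp only [Test.Holds, h16, (h.congr (e.mono le_rfl (by norm_num))).reps]
      omega)
    (by
      rintro i hi s1 ⟨e1, h16, h17, h5, hfound⟩
      have hL1 := h.congr (e1.mono le_rfl (by norm_num))
      refine HaltsIn.seq (distProg_spec (x ⟨t, ht⟩) (x (rep i)) (by norm_num) (by norm_num)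
        (by norm_num) hL1.one hL1.lastCoord hL1.zero
        (fun j => by rw [hL1.addr]; exact hL1.pts ⟨t, ht⟩ le_rfl j)
        (fun j => by rw [h17]; exact hL1.rep_pts i hi j)) ?_
      rintro s2 ⟨e2, hr, hd⟩
      have e2' : EqBelow 14 4 s s2 := e1.trans (e2.mono (by norm_num) le_rfl)
      have hL2 := h.congr (e2'.mono le_rfl (by norm_num))
      have h16 := (e2.nat 16 (by norm_num)).trans h16
      have h17 := (e2.nat 17 (by norm_num)).trans h17
      have h5 := (hr 5 (by norm_num) (by norm_num)).trans h5
      rw [← e2.nat 15 (by norm_num)] at hfound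
      refine HaltsIn.seq (R := fun s' => EqBelow 14 4 s s' ∧ s'.natReg 16 = i + 1 ∧
        s'.natReg 17 = i * d ∧ s'.realReg 5 = ε ^ 2 / 16 * m ⟨t, ht⟩ ∧
        ((s'.natReg 15 = 0 ∧ ∀ r < i + 1, ε ^ 2 / 16 * m ⟨t, ht⟩ < sqDist x ⟨t, ht⟩ (rep r)) ∨
          ∃ r < R, s'.natReg 15 = r + 1 ∧ sqDist x ⟨t, ht⟩ (rep r) ≤ ε ^ 2 / 16 * m ⟨t, ht⟩))
        (HaltsIn.ite ?_ ?_) ?_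
      · intro hc
        simp only [Test.Holds, hd, h5] at hc
        refine HaltsIn.block ⟨e2'.trans (EqBelow.runBlock (by simp [Instr.Keeps]) _), ?_, ?_, ?_,
          Or.inr ⟨i, hi, ?_, hc⟩⟩
        · simp [runBlock, Instr.run, h16]
        · simp [runBlock, Instr.run, h17]
        · simp [runBlock, Instr.run, h5]
        · simp [runBlock, Instr.run, h16, hL2.zero]
      · intro hc
        simp only [Test.Holds, hd, h5, not_le] at hc
        refine (HaltsIn.block (l := []) ⟨e2', h16, h17, h5, ?_⟩).weaken (by simp) fun _ h => h
        rcases hfound with ⟨h0, hfar⟩ | hex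
        · refine Or.inl ⟨h0, fun r hr => ?_⟩
          rcases Nat.lt_succ_iff_lt_or_eq.1 hr with hr | rfl
          · exact hfar r hr
          · exact hc
        · exact Or.inr hex
      · rintro s3 ⟨e3, h16, h17, h5, hfound⟩
        have hL3 := h.congr (e3.mono le_rfl (by norm_num))
        refine HaltsIn.block ⟨e3.trans (EqBelow.runBlock (by simp [Instr.Keeps]) _), ?_, ?_, ?_, ?_⟩
        · simp [runBlock, Instr.run, h16, hL3.one]
        · simp [runBlock, Instr.run, h17, hL3.dim, add_mul]
        · simp [runBlock, Instr.run, h5]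
        · simpa [runBlock, Instr.run] using hfound)
  refine (HaltsIn.seq (R := I 0) (HaltsIn.block ⟨?_, ?_, ?_, ?_, Or.inl ⟨?_, ?_⟩⟩)
    hloop).weaken ?_ ?_
  · exact EqBelow.runBlock (by simp [Instr.Keeps]) _
  · simp [runBlock, Instr.run]
  · simp [runBlock, Instr.run]
  · have := h.rad ⟨t, ht⟩
    simp only at this
    simp [runBlock, Instr.run, h.base, h.idx, h.scale, this]
    ring
  · simp [runBlock, Instr.run]
  · simp
  · have := Nat.mul_le_mul_right (10 * d + 13) hR
    simp only [List.length_cons, List.length_nil]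
    ring_nf at this ⊢
    omega
  · rintro s' ⟨e, -, -, -, hfound⟩
    exact ⟨e, hfound⟩

/-- Appends the current point to the representatives. -/
def appendProg : Prog :=
  .seq (block [.natConst 16 0, .natAdd 17 13 9])
    (.seq (.while (.natLe 16 5) (block [.realLoad 4 17, .realStore 11 4, .natAdd 11 11 3,
      .natAdd 17 17 3, .natAdd 16 16 3])) (block [.natAdd 10 10 3]))

theorem appendProg_spec (h : NetLayout x ε m t R rep asg s) (hR : R ≤ t) (ht : t < n) :
    HaltsIn appendProg s (7 * d + 6) fun s' => s'.natMem = s.natMem ∧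
      (∀ a < 14, a ≠ 10 → a ≠ 11 → s'.natReg a = s.natReg a) ∧
      s'.natReg 10 = R + 1 ∧ s'.natReg 11 = (R + 1) * d ∧ s'.realReg 1 = s.realReg 1 ∧
      (∀ a, a < R * d ∨ (R + 1) * d ≤ a → s'.realMem a = s.realMem a) ∧
      ∀ j : Fin d, s'.realMem (R * d + j) = x ⟨t, ht⟩ j := by
  have hRt : R * d ≤ t * d := Nat.mul_le_mul_right d hR
  let I : ℕ → State → Prop := fun i s' => s'.natMem = s.natMem ∧
    (∀ a < 14, a ≠ 11 → s'.natReg a = s.natReg a) ∧ s'.natReg 11 = R * d + i ∧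
    s'.natReg 16 = i ∧ s'.natReg 17 = t * d + i ∧ s'.realReg 1 = s.realReg 1 ∧
    (∀ a, a < R * d ∨ R * d + i ≤ a → s'.realMem a = s.realMem a) ∧
    ∀ j : Fin d, (j : ℕ) < i → s'.realMem (R * d + j) = x ⟨t, ht⟩ j
  have hloop := HaltsIn.for (c := .natLe 16 5) (I := I) (N := d) (T := 6)
    (p := block [.realLoad 4 17, .realStore 11 4, .natAdd 11 11 3, .natAdd 17 17 3,
      .natAdd 16 16 3])
    (by
      rintro i - s1 ⟨-, hreg, -, h16, -⟩
      have := h.lastCoord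
      simp only [Test.Holds, h16, hreg 5 (by norm_num) (by norm_num)]
      omega)
    (by
      rintro i hi s1 ⟨hmem, hreg, h11, h16, h17, hr1, hkeep, hcopy⟩
      have h3 : s1.natReg 3 = 1 := (hreg 3 (by norm_num) (by norm_num)).trans h.one
      -- As `R ≤ t`, the write position never overtakes the read position; for `R = t` each cell is
      -- copied to itself.
      have hread : s1.realMem (t * d + i) = x ⟨t, ht⟩ ⟨i, hi⟩ := by
        rw [hkeep _ (by omega)]
        exact h.pts ⟨t, ht⟩ le_rfl ⟨i, hi⟩
      refine HaltsIn.block ⟨?_, ?_, ?_, ?_, ?_, ?_, ?_, ?_⟩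
      · simpa [runBlock, Instr.run] using hmem
      · intro a ha ha'
        rw [← hreg a ha ha']
        simp [runBlock, Instr.run, ha', show a ≠ 16 by omega,
          show a ≠ 17 by omega]
      · simp [runBlock, Instr.run, h11, h3, add_assoc]
      · simp [runBlock, Instr.run, h16, h3]
      · simp [runBlock, Instr.run, h17, h3, add_assoc]
      · simpa [runBlock, Instr.run] using hr1
      · intro a ha
        rw [← hkeep a (by omega)]
        simp [runBlock, Instr.run, h11, Function.update_apply]
        omega
      · intro j hj
        by_cases hji : (j : ℕ) = i
        · have : j = ⟨i, hi⟩ := Fin.ext hji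
          subst this
          simp [runBlock, Instr.run, h11, h17, hread]
        · rw [← hcopy j (by omega)]
          simp [runBlock, Instr.run, h11, hji])
  refine (HaltsIn.seq (R := I 0) (HaltsIn.block ⟨?_, ?_, ?_, ?_, ?_, ?_, ?_, ?_⟩) fun s1 hs1 =>
    HaltsIn.seq (hloop s1 hs1) ?_).weaken (T := 3 + ((d * 7 + 1) + 2)) (by omega) fun _ h => h
  · simp [runBlock, Instr.run]
  · intro a ha ha'
    simp [runBlock, Instr.run, show a ≠ 16 by omega,
      show a ≠ 17 by omega]
  · simp [runBlock, Instr.run, h.dest]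
  · simp [runBlock, Instr.run]
  · simp [runBlock, Instr.run, h.addr, h.zero]
  · simp [runBlock, Instr.run]
  · intro a _
    simp [runBlock, Instr.run]
  · simp
  · rintro s2 ⟨hmem, hreg, h11, -, -, hr1, hkeep, hcopy⟩
    refine HaltsIn.block ⟨?_, ?_, ?_, ?_, ?_, ?_, ?_⟩
    · simpa [runBlock, Instr.run] using hmem
    · intro a ha ha' ha''
      rw [← hreg a ha ha'']
      simp [runBlock, Instr.run, ha']
    · simp [runBlock, Instr.run, hreg, h.reps, h.one]
    · simp [runBlock, Instr.run, h11, add_mul]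
    · simpa [runBlock, Instr.run] using hr1
    · intro a ha
      rw [add_mul, one_mul] at ha
      rw [← hkeep a ha]
      simp [runBlock, Instr.run]
    · intro j
      rw [← hcopy j j.2]
      simp [runBlock, Instr.run]

/-- Assigns every point to a representative. -/
def netProg : Prog :=
  .seq (block [.natConst 10 0, .natConst 11 0, .natConst 12 0, .natConst 13 0])
    (.while (.natLe 12 4) (.seq lookupProg
      (.seq (.ite (.natLe 15 9) appendProg
          (block [.natSub 15 15 3, .natLoad 16 15, .natAdd 16 16 3, .natStore 15 16]))
        (block [.natAdd 12 12 3, .natAdd 13 13 1]))))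

/-- The state after the points up to `t` have been assigned. -/
def NetState (x : Fin n → EuclideanSpace ℝ (Fin d)) (ε : ℝ) (m : Fin n → ℝ) (t : ℕ)
    (s : State) : Prop :=
  ∃ R rep asg, Net x m (ε ^ 2 / 16) t R rep asg ∧ NetLayout x ε m t R rep asg s

theorem netBody_spec (hm : ∀ i, 0 ≤ m i) (ht : t < n) (h : NetState x ε m t s) :
    HaltsIn (.seq lookupProg
      (.seq (.ite (.natLe 15 9) appendProg
          (block [.natSub 15 15 3, .natLoad 16 15, .natAdd 16 16 3, .natStore 15 16]))
        (block [.natAdd 12 12 3, .natAdd 13 13 1]))) s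
      (7 + (n * (10 * d + 13) + 1) + (7 * d + 7 + 3)) (NetState x ε m (t + 1)) := by
  obtain ⟨R, rep, asg, hN, hL⟩ := h
  refine HaltsIn.seq (lookupProg_spec hL (hN.le.trans ht.le) ht) ?_
  rintro s1 ⟨e1, hfound⟩
  have hL1 := hL.congr (e1.mono le_rfl (by norm_num))
  have hrlt : ∀ {r : ℕ} (j : Fin d), r < R → r * d + j < R * d := fun {r} j hr => by
    have := Nat.mul_le_mul_right d (Nat.succ_le_of_lt hr)
    rw [Nat.succ_mul] at this
    omega
  have hRn : (R + 1) * d ≤ n * d := Nat.mul_le_mul_right d (by have := hN.le; omega)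
  have hRt : (R + 1) * d ≤ (t + 1) * d := Nat.mul_le_mul_right d (by have := hN.le; omega)
  rcases hfound with ⟨h15, hfar⟩ | ⟨r, hr, h15, hnear⟩
  · have hN' := hN.insert ht (mul_nonneg (by positivity) (hm _)) hfar
    refine HaltsIn.seq (T := 7 * d + 6 + 1) (HaltsIn.ite
      (fun _ => appendProg_spec hL1 hN.le ht) (fun hc => ?_)) ?_
    · simp [Test.Holds, h15] at hc
    · rintro s2 ⟨hmem, hreg, h10, h11, hr1, hkeep, hcopy⟩
      refine HaltsIn.block ⟨R + 1, _, _, hN', ?_, ?_, ?_, ?_, ?_, ?_, ?_, ?_, ?_, ?_, ?_, ?_, ?_,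
        ?_, ?_, ?_⟩
      · simp [runBlock, Instr.run, hreg, hL1.dim]
      · simp [runBlock, Instr.run, hreg, hL1.one]
      · simp [runBlock, Instr.run, hreg, hL1.last]
      · simp [runBlock, Instr.run, hreg, hL1.lastCoord]
      · simp [runBlock, Instr.run, hreg, hL1.base]
      · simp [runBlock, Instr.run, hreg, hL1.zero]
      · simp [runBlock, Instr.run, h10]
      · simp [runBlock, Instr.run, h11]
      · simp [runBlock, Instr.run, hreg, hL1.idx, hL1.one]
      · simp [runBlock, Instr.run, hreg, hL1.addr, hL1.dim, add_mul]
      · simp [runBlock, Instr.run, hr1, hL1.scale]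
      · intro r hr j
        have : (runBlock [Instr.natAdd 12 12 3, Instr.natAdd 13 13 1] s2).realMem = s2.realMem := by
          simp [runBlock, Instr.run]
        rw [this]
        rcases Nat.lt_succ_iff_lt_or_eq.1 hr with hr | rfl
        · rw [hkeep _ (Or.inl (hrlt j hr)), Function.update_of_ne hr.ne]
          exact hL1.rep_pts r hr j
        · rw [Function.update_self]
          exact hcopy j
      · intro i hi j
        have : (runBlock [Instr.natAdd 12 12 3, Instr.natAdd 13 13 1] s2).realMem = s2.realMem := by
          simp [runBlock, Instr.run]
        have h1 := Nat.mul_le_mul_right d hi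
        rw [this, hkeep _ (Or.inr (by omega))]
        exact hL1.pts i (by omega) j
      · intro i
        have : (runBlock [Instr.natAdd 12 12 3, Instr.natAdd 13 13 1] s2).realMem = s2.realMem := by
          simp [runBlock, Instr.run]
        rw [this, hkeep _ (Or.inr (by omega))]
        exact hL1.rad i
      · intro r hr
        have : (runBlock [Instr.natAdd 12 12 3, Instr.natAdd 13 13 1] s2).natMem = s2.natMem := by
          simp [runBlock, Instr.run]
        rw [this, hmem]
        rcases Nat.lt_succ_iff_lt_or_eq.1 hr with hr | rfl
        · rw [load_succ_of_ne asg ht hr.ne]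
          exact hL1.mult r hr
        -- The new multiplicity `0 + 1` is already in memory as the flag.
        · rw [load_succ_self, hN.load_eq_zero]
          exact hL1.flag r le_rfl (hN.le.trans_lt ht)
      · intro r hr hrn
        have : (runBlock [Instr.natAdd 12 12 3, Instr.natAdd 13 13 1] s2).natMem = s2.natMem := by
          simp [runBlock, Instr.run]
        rw [this, hmem]
        exact hL1.flag r (by omega) hrn
  · have hN' := hN.join ht hr hnear
    -- Between the increment of the multiplicity and the update of the counters neither layout
    -- holds, so the old one is asserted with the old natural memory and the change is recorded
    -- separately.
    refine HaltsIn.seq (T := 7 * d + 6 + 1) (HaltsIn.ite (fun hc => ?_) (fun _ =>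
      (HaltsIn.block (Q := fun s' => NetLayout x ε m t R rep asg
        { s' with natMem := s1.natMem } ∧
        s'.natMem = Function.update s1.natMem r (load asg t r + 1)) ⟨?_, ?_⟩).weaken
          (by simp) fun _ h => h)) ?_
    · simp [Test.Holds, h15, hL1.zero] at hc
    · refine hL1.congr ⟨rfl, ?_, ?_, ?_⟩
      · simp [runBlock, Instr.run]
      · intro a ha
        simp [runBlock, Instr.run, show a ≠ 15 by omega,
          show a ≠ 16 by omega]
      · intro a ha
        simp [runBlock, Instr.run]
    · simp [runBlock, Instr.run, h15, hL1.one, hL1.mult r hr]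
    · rintro s2 ⟨hL2, hmem⟩
      refine HaltsIn.block ⟨R, _, _, hN', ?_, ?_, ?_, ?_, ?_, ?_, ?_, ?_, ?_, ?_, ?_, ?_, ?_,
        ?_, ?_, ?_⟩
      · simpa [runBlock, Instr.run] using hL2.dim
      · simpa [runBlock, Instr.run] using hL2.one
      · simpa [runBlock, Instr.run] using hL2.last
      · simpa [runBlock, Instr.run] using hL2.lastCoord
      · simpa [runBlock, Instr.run] using hL2.base
      · simpa [runBlock, Instr.run] using hL2.zero
      · simpa [runBlock, Instr.run] using hL2.reps
      · simpa [runBlock, Instr.run] using hL2.dest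
      · have h1 := hL2.idx
        have h2 := hL2.one
        simp only at h1 h2
        simp [runBlock, Instr.run, h1, h2]
      · have h1 := hL2.addr
        have h2 := hL2.dim
        simp only at h1 h2
        simp [runBlock, Instr.run, h1, h2, add_mul]
      · simpa [runBlock, Instr.run] using hL2.scale
      · intro r hr j
        simpa [runBlock, Instr.run] using hL2.rep_pts r hr j
      · intro i hi j
        simpa [runBlock, Instr.run] using hL2.pts i (by omega) j
      · intro i
        simpa [runBlock, Instr.run] using hL2.rad i
      · intro r' hr'
        have : (runBlock [Instr.natAdd 12 12 3, Instr.natAdd 13 13 1] s2).natMem = s2.natMem := by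
          simp [runBlock, Instr.run]
        rw [this, hmem]
        by_cases hrr : r' = r
        · subst hrr
          rw [Function.update_self, load_succ_self]
        · rw [Function.update_of_ne hrr, load_succ_of_ne asg ht hrr]
          exact hL1.mult r' hr'
      · intro r' hr' hrn
        have : (runBlock [Instr.natAdd 12 12 3, Instr.natAdd 13 13 1] s2).natMem = s2.natMem := by
          simp [runBlock, Instr.run]
        rw [this, hmem, Function.update_of_ne (by omega)]
        exact hL1.flag r' hr' hrn

theorem netProg_spec (h : Layout x k ε ∅ m s) (hm : ∀ i, 0 ≤ m i) :
    HaltsIn netProg s (5 + (n * (7 + (n * (10 * d + 13) + 1) + (7 * d + 7 + 3) + 1) + 1))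
      (NetState x ε m n) := by
  have hn : 0 < n := by have := h.last; omega
  have hloop := HaltsIn.for (c := .natLe 12 4) (I := NetState x ε m) (N := n)
    (by
      rintro t - s1 ⟨R, rep, asg, -, hL⟩
      have := hL.last
      simp only [Test.Holds, hL.idx]
      omega)
    (fun t ht s1 hs1 => netBody_spec hm ht hs1)
  refine (HaltsIn.seq (R := NetState x ε m 0) (HaltsIn.block ?_) hloop).weaken (by simp)
    fun _ h => h
  refine ⟨0, fun _ => ⟨0, hn⟩, fun _ => 0, ⟨le_rfl, ?_, ?_, ?_, ?_, ?_, ?_⟩, ?_, ?_, ?_, ?_, ?_, ?_,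
    ?_, ?_, ?_, ?_, ?_, ?_, ?_, ?_, ?_, ?_⟩
  · simp
  · simp
  · simp
  · simp
  · simp
  · simp
  · simp [runBlock, Instr.run, h.dim]
  · simp [runBlock, Instr.run, h.one]
  · simp [runBlock, Instr.run, h.last]
  · simp [runBlock, Instr.run, h.lastCoord]
  · simp [runBlock, Instr.run, h.base]
  · simp [runBlock, Instr.run, h.zero]
  · simp [runBlock, Instr.run]
  · simp [runBlock, Instr.run]
  · simp [runBlock, Instr.run]
  · simp [runBlock, Instr.run]
  · simp [runBlock, Instr.run, h.scale]
  · simp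
  · intro i _ j
    simpa [runBlock, Instr.run] using h.pts i j
  · intro i
    simpa [runBlock, Instr.run] using h.rad i
  · simp
  · intro r _ hr
    simpa [runBlock, Instr.run] using h.flag ⟨r, hr⟩

end

/-! ### Initialization and assembly of the whole program. -/

/-- Sets up the constants that are used by the other parts. -/
def initProg : Prog :=
  .seq (block [.natConst 3 1, .natSub 4 0 3, .natSub 5 1 3, .natAdd 6 2 2, .natAdd 8 0 9,
      .realMul 1 0 0, .realConst 2 16, .realDiv 1 1 2])
    -- `n * d` by repeated addition.
    (.while (.natLe 12 4) (block [.natAdd 7 7 1, .natAdd 12 12 3]))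

theorem initProg_spec {d n k : ℕ} {ε : ℝ} (x : Fin n → EuclideanSpace ℝ (Fin d)) (hn : 1 ≤ n)
    (hd : 1 ≤ d) :
    HaltsIn initProg (inputState k ε x) (9 + (n * 4 + 1))
      (Layout x k ε Finset.univ fun _ => 0) := by
  have hpts : ∀ (i : Fin n) (j : Fin d), (inputState k ε x).realMem (i * d + j) = x i j := by
    intro i j
    have hlt : (i : ℕ) * d + j < n * d := by
      have := Nat.mul_le_mul_right d i.2
      rw [Nat.succ_mul] at this
      omega
    have he : (⟨(i : ℕ) * d + j, hlt⟩ : Fin (n * d)) = finProdFinEquiv (i, j) := by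
      ext
      simp [finProdFinEquiv]
      ring
    simp only [inputState, hlt, dif_pos, he, Equiv.symm_apply_apply]
  let I : ℕ → State → Prop := fun t s' => s'.natMem = (inputState k ε x).natMem ∧
    s'.realMem = (inputState k ε x).realMem ∧ s'.natReg 1 = d ∧ s'.natReg 3 = 1 ∧
    s'.natReg 4 + 1 = n ∧ s'.natReg 5 + 1 = d ∧ s'.natReg 6 = 2 * k ∧ s'.natReg 7 = t * d ∧
    s'.natReg 8 = n ∧ s'.natReg 9 = 0 ∧ s'.natReg 12 = t ∧ s'.realReg 1 = ε ^ 2 / 16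
  have hloop := HaltsIn.for (c := .natLe 12 4) (I := I) (N := n) (T := 3)
    (p := block [.natAdd 7 7 1, .natAdd 12 12 3])
    (by
      rintro i - s' ⟨-, -, -, -, h4, -, -, -, -, -, h12, -⟩
      simp only [Test.Holds, h12]
      omega)
    (by
      rintro i hi s' ⟨hm, hrm, h1, h3, h4, h5, h6, h7, h8, h9, h12, hr⟩
      refine HaltsIn.block ⟨?_, ?_, ?_, ?_, ?_, ?_, ?_, ?_, ?_, ?_, ?_, ?_⟩ <;>
        simp [runBlock, Instr.run, hm, hrm, h1, h3, h4, h5, h6, h7, h8, h9, h12, hr, add_mul])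
  refine (HaltsIn.seq (R := I 0) (HaltsIn.block ⟨?_, ?_, ?_, ?_, ?_, ?_, ?_, ?_, ?_, ?_, ?_, ?_⟩)
    hloop).weaken (by simp) ?_
  · simp [runBlock, Instr.run]
  · simp [runBlock, Instr.run]
  · simp [runBlock, Instr.run, inputState]
  · simp [runBlock, Instr.run]
  · simp [runBlock, Instr.run, inputState]
    omega
  · simp [runBlock, Instr.run, inputState]
    omega
  · simp [runBlock, Instr.run, inputState]
    omega
  · simp [runBlock, Instr.run, inputState]
  · simp [runBlock, Instr.run, inputState]
  · simp [runBlock, Instr.run, inputState]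
  · simp [runBlock, Instr.run, inputState]
  · simp [runBlock, Instr.run, inputState, sq]
  · rintro s' ⟨hm, hrm, h1, h3, h4, h5, h6, h7, h8, h9, h12, hr⟩
    refine ⟨h1, h3, h4, h5, h6, h7, by simpa using h8, h9, hr, ?_, ?_, ?_⟩
    · rw [hrm]
      exact hpts
    · intro i
      rw [hrm]
      simp [inputState]
    · intro i
      rw [hm]
      simp [inputState]

/-- Computes a simultaneous coreset. -/
def coresetProg : Prog :=
  .seq initProg (.seq peelProg (.seq netProg (block [.natAdd 0 10 9])))

/-- A bound for the number of steps of `coresetProg`. -/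
def coresetTime {S : Type*} [Semiring S] (n d : S) : S :=
  (9 + (n * 4 + 1)) + ((n * (roundTime n d + 1) + 1) +
    ((5 + (n * (7 + (n * (10 * d + 13) + 1) + (7 * d + 7 + 3) + 1) + 1)) + 2))

theorem coresetTime_mono {n d n' d' : ℕ} (hn : n ≤ n') (hd : d ≤ d') :
    coresetTime n d ≤ coresetTime n' d' := by
  unfold coresetTime roundTime
  gcongr

/-- The time bound is written over an arbitrary semiring so that one expression is both a number of
steps and a polynomial. -/
theorem eval_coresetTime (N : ℕ) :
    (coresetTime (Polynomial.X : Polynomial ℕ) Polynomial.X).eval N = coresetTime N N := by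
  simp [coresetTime, roundTime]

/-- The final state represents the multiset of the representatives of all points. -/
theorem NetLayout.represents {d n : ℕ} {x : Fin n → EuclideanSpace ℝ (Fin d)}
    (hx : Function.Injective x) {ε c : ℝ} {m : Fin n → ℝ} {R : ℕ} {rep : ℕ → Fin n}
    {asg : Fin n → ℕ} (hN : Net x m c n R rep asg) {s s' : State}
    (hL : NetLayout x ε m n R rep asg s) (h0 : s'.natReg 0 = R) (hnat : s'.natMem = s.natMem)
    (hreal : s'.realMem = s.realMem) :
    size (Finset.univ.val.map fun i => x (rep (asg i))) = R ∧
      Represents s' (Finset.univ.val.map fun i => x (rep (asg i))) := by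
  classical
  have hinj : ∀ r < R, ∀ r' < R, rep r = rep r' → r = r' := by
    intro r hr r' hr' he
    rw [← hN.asg_rep r hr, ← hN.asg_rep r' hr', he]
  have hsize : size (Finset.univ.val.map fun i => x (rep (asg i))) = R := by
    have : (Finset.univ.val.map fun i => x (rep (asg i))).toFinset =
        (Finset.range R).image fun r => x (rep r) := by
      ext p
      simp only [Multiset.mem_toFinset, Multiset.mem_map, Finset.mem_val, Finset.mem_univ,
        true_and, Finset.mem_image, Finset.mem_range]
      constructor
      · rintro ⟨i, rfl⟩
        exact ⟨asg i, hN.asg_lt i i.2, rfl⟩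
      · rintro ⟨r, hr, rfl⟩
        exact ⟨rep r, by rw [hN.asg_rep r hr]⟩
    unfold size
    refine (congrArg Finset.card (Eq.trans (by congr!) this)).trans ?_
    rw [Finset.card_image_of_injOn, Finset.card_range]
    intro r hr r' hr' he
    exact hinj r (Finset.mem_range.1 hr) r' (Finset.mem_range.1 hr') (hx he)
  refine ⟨hsize, ?_⟩
  have hlt : ∀ i : Fin (size (Finset.univ.val.map fun i => x (rep (asg i)))), (i : ℕ) < R :=
    fun i => i.2.trans_eq hsize
  refine ⟨h0.trans hsize.symm, fun i => x (rep i), ?_, fun i => ⟨?_, ?_, fun j => ?_⟩⟩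
  · intro i i' he
    exact Fin.ext (hinj i (hlt i) i' (hlt i') (hx he))
  · exact Multiset.mem_map.2 ⟨rep i, Finset.mem_univ_val _, by rw [hN.asg_rep i (hlt i)]⟩
  -- Distinct numbers give distinct representatives, so the count of a point in the multiset is the
  -- load of its number.
  · rw [hnat, hL.mult i (hlt i), Multiset.count_map]
    unfold load
    rw [Finset.card_def, Finset.filter_val]
    congr 1
    refine Multiset.filter_congr fun l _ => ?_
    constructor
    · rintro ⟨-, he⟩
      rw [he]
    · intro he
      exact ⟨l.2, (hinj i (hlt i) (asg l) (hN.asg_lt l l.2) (hx he)).symm⟩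
  · rw [hreal]
    exact hL.rep_pts i (hlt i) j

theorem coresetProg_spec {d n k : ℕ} {ε : ℝ} {x : Fin n → EuclideanSpace ℝ (Fin d)}
    (hn : 2 ≤ n) (hd : 1 ≤ d) (hk : 1 ≤ k) (hε : 0 < ε) (hε1 : ε < 1)
    (hx : Function.Injective x) :
    ∃ D : Multiset (EuclideanSpace ℝ (Fin d)),
      IsSimultaneousCoreset k ε (Finset.univ.val.map x) D ∧
      (size D : ℝ) ≤ 54 ^ d * ((k : ℝ) ^ 2 * Real.log n ^ 2 / ε ^ d) ∧
      HaltsIn coresetProg (inputState k ε x) (coresetTime n d) fun s => Represents s D := by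
  have hrun : HaltsIn coresetProg (inputState k ε x) (coresetTime n d) fun s' =>
      ∃ m, Peeled x k ∅ m ∧ ∃ R rep asg s, Net x m (ε ^ 2 / 16) n R rep asg ∧
        NetLayout x ε m n R rep asg s ∧ s'.natReg 0 = R ∧ s'.natMem = s.natMem ∧
        s'.realMem = s.realMem := by
    refine HaltsIn.seq (initProg_spec x (by omega) hd) fun s1 h1 => ?_
    have hpeel := peelProg_spec hk h1 (peeled_univ (by omega) x k _)
    rw [Finset.card_univ, Fintype.card_fin] at hpeel
    refine HaltsIn.seq hpeel fun s2 ⟨m, h2, hP⟩ => ?_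
    have hm : ∀ i, 0 ≤ m i := by
      obtain ⟨N, u, col, ctr, h⟩ := hP
      exact fun i => h.nonneg i (Finset.notMem_empty i)
    refine HaltsIn.seq (netProg_spec h2 hm) fun s3 ⟨R, rep, asg, hN, h3⟩ => ?_
    refine HaltsIn.block ⟨m, hP, R, rep, asg, s3, hN, h3, ?_, ?_, ?_⟩
    · simp [runBlock, Instr.run, h3.reps, h3.zero]
    · simp [runBlock, Instr.run]
    · simp [runBlock, Instr.run]
  obtain ⟨t, s', hexec, ht, m, hP, R, rep, asg, s, hN, hL, h0, hnat, hreal⟩ := hrun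
  obtain ⟨hsize, hrep⟩ := hL.represents hx hN h0 hnat hreal
  refine ⟨Finset.univ.val.map fun i => x (rep (asg i)), ?_, ?_, t, s', hexec, ht, hrep⟩
  · exact hP.isSimultaneousCoreset hε _ fun i => hN.near i i.2
  · have hinj : Set.InjOn rep (Finset.range R : Finset ℕ) := by
      intro r hr r' hr' he
      rw [← hN.asg_rep r (by simpa using hr), ← hN.asg_rep r' (by simpa using hr'), he]
    -- Representatives are numbered in the order of their indices, so the separation of the net has
    -- the orientation `i < j` required here.
    have hcard := hP.card_le hn hd hx hk hε hε1 ((Finset.range R).image rep) (by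
      intro i hi j hj hij
      simp only [Finset.mem_image, Finset.mem_range] at hi hj
      obtain ⟨r, hr, rfl⟩ := hi
      obtain ⟨r', hr', rfl⟩ := hj
      refine hN.sep r r' ?_ hr'
      rcases lt_trichotomy r r' with h | h | h
      · exact h
      · rw [h] at hij
        exact absurd hij (lt_irrefl _)
      · exact absurd (hN.rep_mono r' r h hr) (not_lt.2 hij.le))
    rwa [Finset.card_image_of_injOn hinj, Finset.card_range, ← hsize] at hcard

end RealRAM

end

theorem theorem4p5 :
    ∃ (prog : RealRAM.Prog) (P : Polynomial ℕ) (A : ℝ),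
      ∀ (d n k : ℕ) (ε : ℝ) (x : Fin n → EuclideanSpace ℝ (Fin d)),
        2 ≤ n → 1 ≤ k → 0 < ε → ε < 1 → Function.Injective x →
        ∃ D : Multiset (EuclideanSpace ℝ (Fin d)),
          OrderedMedian.IsSimultaneousCoreset k ε (Finset.univ.val.map x) D ∧
          (OrderedMedian.size D : ℝ) ≤ A ^ d * ((k : ℝ) ^ 2 * Real.log n ^ 2 / ε ^ d) ∧
          ∃ (t : ℕ) (s : RealRAM.State),
            RealRAM.Exec prog (RealRAM.inputState k ε x) t s ∧
            t ≤ P.eval (n * d) ∧ RealRAM.Represents s D := by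
  refine ⟨RealRAM.coresetProg, RealRAM.coresetTime Polynomial.X Polynomial.X, 54, ?_⟩
  intro d n k ε x hn hk hε hε1 hx
  -- In dimension `0` the two points would coincide. Hence `n` and `d` are both at most `n * d`, and
  -- a polynomial in the single variable `n * d` suffices.
  have hd : 1 ≤ d := by
    rcases Nat.eq_zero_or_pos d with rfl | hd
    · have := hx (Subsingleton.elim (x ⟨0, by omega⟩) (x ⟨1, by omega⟩))
      simp at this
    · exact hd
  obtain ⟨D, hD, hsize, t, s, hexec, ht, hrep⟩ :=
    RealRAM.coresetProg_spec hn hd hk hε hε1 hx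
  refine ⟨D, hD, hsize, t, s, hexec, ht.trans ?_, hrep⟩
  rw [RealRAM.eval_coresetTime]
  exact RealRAM.coresetTime_mono (Nat.le_mul_of_pos_right n hd)
    (Nat.le_mul_of_pos_left d (by omega))
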